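/- Let $N\ge 2$, $0<\alpha\le 2$, $\alpha\ne N$, and let $E\subset\mathbb R^N$ be a compact set whose minimum $\alpha$-energy $$W_\alpha(E)=\inf_{\mu}\iint |x-y|^{\alpha-N}\,d\mu(x)\,d\mu(y)$$ (infimum over all Borel probability measures $\mu$ carried by $E$) is finite. Let $\mu_\alpha$ be the $\alpha$-equilibrium measure of $E$, that is, the Borel probability measure carried by $E$ whose $\alpha$-energy equals $W_\alpha(E)$; put $d_E(x)=\sup_{t\in E}|x-t|$ and, for $m\in\mathbb N$, $m\ge 2$, $$C_E(\alpha,m)=\min_{c_1,\dots,c_m\in E}\int\min_{1\le k\le m}|x-c_k|^{\alpha-N}\,d\mu_\alpha(x)-W_\alpha(E),\qquad C_E(\alpha)=\int d_E(x)^{\alpha-N}\,d\mu_\alpha(x)-W_\alpha(E).$$ A closed set $S\subset E$ is called dominant if $d_E(x)=\max_{t\in S}|x-t|$ for all $x\in\operatorname{supp}\mu_\alpha$. Suppose that $E$ has finitely many connected components and that its boundary is $C^1$-smooth, i.e. $\partial E$ is an embedded $C^1$ hypersurface: every $p\in\partial E$ has an open neighbourhood $U$ with a $C^1$ function $g:U\to\mathbb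 R$ such that $\nabla g(p)\ne 0$ and $\partial E\cap U=\{x\in U: g(x)=0\}$. Then the measure $\mu_\alpha$ exists, $C_E(\alpha,m)>C_E(\alpha)$ for every integer $m\ge 2$, and every dominant set is infinite (so the minimal dominant set of $E$, a dominant set with the smallest number of points, is infinite). -/

import Mathlib

open MeasureTheory Set
open scoped ENNReal

noncomputable section

namespace RieszPotential

/-- The Riesz kernel `|x - y| ^ (α - N)` on `ℝ^N`, with values in `[0, ∞]`; it is `∞` on the
diagonal when `α < N`. -/
def kernel {N : ℕ} (α : ℝ) (x y : EuclideanSpace ℝ (Fin N)) : ℝ≥0∞ :=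
  edist x y ^ (α - (N : ℝ))

/-- The Riesz potential `U_α^μ (x) = ∫ |x - t| ^ (α - N) dμ(t)`. -/
def potential {N : ℕ} (α : ℝ) (μ : Measure (EuclideanSpace ℝ (Fin N)))
    (x : EuclideanSpace ℝ (Fin N)) : ℝ≥0∞ :=
  ∫⁻ t, kernel α x t ∂μ

/-- The `α`-energy `∫ U_α^μ dμ`. -/
def energy {N : ℕ} (α : ℝ) (μ : Measure (EuclideanSpace ℝ (Fin N))) : ℝ≥0∞ :=
  ∫⁻ x, potential α μ x ∂μ

/-- The minimum `α`-energy `W_α(E)`, over all unit Borel measures carried by `E`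
(it is `∞` if no such measure has finite energy). -/
def minEnergy {N : ℕ} (α : ℝ) (E : Set (EuclideanSpace ℝ (Fin N))) : ℝ≥0∞ :=
  ⨅ (μ : Measure (EuclideanSpace ℝ (Fin N))) (_ : IsProbabilityMeasure μ) (_ : μ Eᶜ = 0),
    energy α μ

/-- `μ` is an `α`-equilibrium measure of `E`: a unit measure carried by `E` whose `α`-energy is
the minimum `W_α(E)`. -/
structure IsEquilibriumMeasure {N : ℕ} (α : ℝ) (E : Set (EuclideanSpace ℝ (Fin N)))
    (μ : Measure (EuclideanSpace ℝ (Fin N))) : Prop where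
  isProbabilityMeasure : IsProbabilityMeasure μ
  carried : μ Eᶜ = 0
  energy_eq : energy α μ = minEnergy α E

/-- The farthest distance function `d_E(x) = sup_{t ∈ E} |x - t|`. -/
def farthestDist {N : ℕ} (E : Set (EuclideanSpace ℝ (Fin N)))
    (x : EuclideanSpace ℝ (Fin N)) : ℝ≥0∞ :=
  ⨆ t ∈ E, edist x t

/-- `C_E(α, m) = min_{c_1, …, c_m ∈ E} ∫ min_k |x - c_k| ^ (α - N) dμ(x) - W_α(E)`, where `μ` is
the equilibrium measure. -/
def constFin {N : ℕ} (α : ℝ) (E : Set (EuclideanSpace ℝ (Fin N)))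
    (μ : Measure (EuclideanSpace ℝ (Fin N))) (m : ℕ) : ℝ :=
  (⨅ c : Fin m → E, ∫⁻ x, ⨅ k : Fin m, kernel α x (c k) ∂μ).toReal - (minEnergy α E).toReal

/-- `C_E(α) = ∫ d_E(x) ^ (α - N) dμ(x) - W_α(E)`, where `μ` is the equilibrium measure. -/
def const {N : ℕ} (α : ℝ) (E : Set (EuclideanSpace ℝ (Fin N)))
    (μ : Measure (EuclideanSpace ℝ (Fin N))) : ℝ :=
  (∫⁻ x, farthestDist E x ^ (α - (N : ℝ)) ∂μ).toReal - (minEnergy α E).toReal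

/-- A closed set `S ⊆ E` is dominant if `d_E(x) = max_{t ∈ S} |x - t|` (the maximum being
attained) for all `x` in the support of the equilibrium measure `μ`. -/
structure IsDominant {N : ℕ} (E : Set (EuclideanSpace ℝ (Fin N)))
    (μ : Measure (EuclideanSpace ℝ (Fin N))) (S : Set (EuclideanSpace ℝ (Fin N))) : Prop where
  isClosed : IsClosed S
  subset : S ⊆ E
  isGreatest : ∀ x ∈ μ.support, IsGreatest ((fun t => edist x t) '' S) (farthestDist E x)

/-- The boundary of `E` is `C^1`-smooth: it is an embedded `C^1` hypersurface, i.e. near each of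
its points it is the zero set of a `C^1` function with non-vanishing differential. -/
def HasC1Boundary {N : ℕ} (E : Set (EuclideanSpace ℝ (Fin N))) : Prop :=
  ∀ p ∈ frontier E, ∃ (U : Set (EuclideanSpace ℝ (Fin N))) (g : EuclideanSpace ℝ (Fin N) → ℝ),
    IsOpen U ∧ p ∈ U ∧ ContDiffOn ℝ 1 g U ∧ fderiv ℝ g p ≠ 0 ∧
      frontier E ∩ U = {x ∈ U | g x = 0}

end RieszPotential

end

open MeasureTheory Set Filter
open scoped ENNReal Topology NNReal

noncomputable section

namespace RieszPotential

variable {N : ℕ} {α : ℝ}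

/-! Write `μ` for an equilibrium measure, `W` for the minimum energy and `U` for the potential of
`μ`. Such a `μ` exists because the energy is lower semicontinuous on the weakly compact set of
probability measures carried by `E`.

The strict inequality reduces to the infinitude of dominant sets. If optimal centres `c_1, …, c_m`
gave equality, then `d_E(x) = max_k |x - c_k|` would hold almost everywhere, hence on the whole
support, and the centres would form a finite dominant set (`const_lt_constFin`).

Suppose that a dominant set `S` is finite. Each point of the support has a farthest point `t` of `E`
in `S`. Since `t` lies on the smooth boundary, the Lagrange condition puts the point on the normal
line at `t`. So the support lies in finitely many lines (`IsDominant.exists_lines`).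

If `α ≤ N - 1`, a measure of finite energy does not charge lines (`measure_line_eq_zero`), which is
absurd. Otherwise `α ≤ 2` and `α ≠ N` force `N = 2` and `1 < α < 2`. Then the boundary contains an
arc off those lines that carries a probability measure `ν` of finite energy
(`exists_arc_avoiding_lines`, `exists_measure_energy_map_lt_top`). In the plane the kernel is
strictly subharmonic off the diagonal, so a maximum principle gives `U < W` off the support
(`potential_lt_of_ae_le`), and `∫ U dν < W`. This contradicts the variational inequality `∫ U dν ≥
W`. -/

/-! ### Kernels, potentials and mutual energies. -/

lemma continuous_kernel_uncurry (α : ℝ) :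
    Continuous fun p : EuclideanSpace ℝ (Fin N) × EuclideanSpace ℝ (Fin N) => kernel α p.1 p.2 :=
  ENNReal.continuous_rpow_const.comp (continuous_fst.edist continuous_snd)

lemma continuous_kernel_left (α : ℝ) (y : EuclideanSpace ℝ (Fin N)) :
    Continuous fun x => kernel α x y :=
  ENNReal.continuous_rpow_const.comp (continuous_id.edist continuous_const)

lemma continuous_kernel_right (α : ℝ) (x : EuclideanSpace ℝ (Fin N)) :
    Continuous fun y => kernel α x y :=
  ENNReal.continuous_rpow_const.comp (continuous_const.edist continuous_id)

lemma kernel_comm (α : ℝ) (x y : EuclideanSpace ℝ (Fin N)) : kernel α x y = kernel α y x := by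
  rw [kernel, kernel, edist_comm]

lemma kernel_le_of_edist_le (hα : α < N) {r : ℝ≥0∞} {x y : EuclideanSpace ℝ (Fin N)}
    (h : r ≤ edist x y) : kernel α x y ≤ r ^ (α - (N : ℝ)) := by
  rw [kernel, ← neg_sub, ENNReal.rpow_neg, ENNReal.rpow_neg, ENNReal.inv_le_inv]
  exact ENNReal.rpow_le_rpow h (by linarith)

lemma kernel_eq_ofReal {x y : EuclideanSpace ℝ (Fin N)} (hxy : x ≠ y) :
    kernel α x y = ENNReal.ofReal (dist x y ^ (α - (N : ℝ))) := by
  rw [kernel, edist_dist, ENNReal.ofReal_rpow_of_pos (dist_pos.2 hxy)]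

lemma measurable_potential (α : ℝ) (μ : Measure (EuclideanSpace ℝ (Fin N))) [SFinite μ] :
    Measurable (potential α μ) :=
  (continuous_kernel_uncurry α).measurable.lintegral_prod_right'

lemma potential_mono {μ ν : Measure (EuclideanSpace ℝ (Fin N))} (h : μ ≤ ν)
    (x : EuclideanSpace ℝ (Fin N)) : potential α μ x ≤ potential α ν x :=
  lintegral_mono' h le_rfl

lemma lintegral_potential_comm (α : ℝ) (μ ν : Measure (EuclideanSpace ℝ (Fin N)))
    [SFinite μ] [SFinite ν] : ∫⁻ x, potential α μ x ∂ν = ∫⁻ x, potential α ν x ∂μ := by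
  simp only [potential]
  rw [lintegral_lintegral_swap (continuous_kernel_uncurry α).measurable.aemeasurable]
  simp only [kernel_comm]

lemma energy_eq_lintegral_prod (α : ℝ) (μ : Measure (EuclideanSpace ℝ (Fin N))) [SFinite μ] :
    energy α μ = ∫⁻ p, kernel α p.1 p.2 ∂(μ.prod μ) :=
  (lintegral_prod _ (continuous_kernel_uncurry α).measurable.aemeasurable).symm

lemma minEnergy_le {E : Set (EuclideanSpace ℝ (Fin N))} {μ : Measure (EuclideanSpace ℝ (Fin N))}
    (h : IsProbabilityMeasure μ) (hE : μ Eᶜ = 0) : minEnergy α E ≤ energy α μ :=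
  iInf_le_of_le μ (iInf_le_of_le h (iInf_le _ hE))

/-! ### Existence of the equilibrium measure. -/

/-- The integral of a continuous `[0, ∞]`-valued function is lower semicontinuous for weak
convergence of probability measures. -/
lemma lowerSemicontinuous_lintegral {X : Type*} [TopologicalSpace X] [MeasurableSpace X]
    [OpensMeasurableSpace X] {f : X → ℝ≥0∞} (hf : Continuous f) :
    LowerSemicontinuous fun μ : ProbabilityMeasure X => ∫⁻ x, f x ∂(μ : Measure X) := by
  -- The truncations `min f n` are bounded and continuous, so their integrals are weakly continuous;
  -- a supremum of continuous functions is lower semicontinuous.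
  have key : ∀ μ : ProbabilityMeasure X,
      ∫⁻ x, f x ∂(μ : Measure X) = ⨆ n : ℕ, ∫⁻ x, min (f x) n ∂(μ : Measure X) := by
    intro μ
    rw [← lintegral_iSup (fun n => (hf.min continuous_const).measurable)]
    · congr 1 with x
      rw [← inf_iSup_eq, ENNReal.iSup_natCast, inf_top_eq]
    · intro m n hmn x
      exact min_le_min le_rfl (by exact_mod_cast hmn)
  simp_rw [key]
  refine lowerSemicontinuous_iSup fun n => Continuous.lowerSemicontinuous ?_
  have hle : ∀ x, min (f x) n ≠ ∞ := fun x =>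
    ((min_le_right _ _).trans_lt (ENNReal.natCast_lt_top n)).ne
  let g : BoundedContinuousFunction X ℝ≥0 :=
    BoundedContinuousFunction.mkOfBound
      ⟨fun x => (min (f x) n).toNNReal, by
        rw [continuous_iff_continuousAt]
        intro x
        exact (ENNReal.tendsto_toNNReal (hle x)).comp
          (hf.min continuous_const).continuousAt⟩ n (by
      intro x y
      have h : ∀ z, ((min (f z) (n : ℝ≥0∞)).toNNReal : ℝ) ≤ n := fun z => by
        exact_mod_cast ENNReal.toNNReal_mono (ENNReal.natCast_ne_top n) (min_le_right (f z) n)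
      simp only [ContinuousMap.coe_mk, NNReal.dist_eq, abs_le]
      constructor <;> linarith [h x, h y, NNReal.coe_nonneg (min (f x) (n : ℝ≥0∞)).toNNReal,
        NNReal.coe_nonneg (min (f y) (n : ℝ≥0∞)).toNNReal])
  have hg : ∀ x, (g x : ℝ≥0∞) = min (f x) n := fun x => ENNReal.coe_toNNReal (hle x)
  rw [continuous_iff_continuousAt]
  intro μ
  have := (ProbabilityMeasure.tendsto_iff_forall_lintegral_tendsto.1 (tendsto_id (x := 𝓝 μ))) g
  simp only [hg] at this
  exact this

lemma lowerSemicontinuous_energy (α : ℝ) :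
    LowerSemicontinuous fun μ : ProbabilityMeasure (EuclideanSpace ℝ (Fin N)) =>
      energy α (μ : Measure (EuclideanSpace ℝ (Fin N))) := by
  simp_rw [energy_eq_lintegral_prod]
  exact (lowerSemicontinuous_lintegral (continuous_kernel_uncurry α)).comp
    (ProbabilityMeasure.continuous_prod.comp (continuous_id.prodMk continuous_id))

theorem exists_isEquilibriumMeasure {E : Set (EuclideanSpace ℝ (Fin N))} (hE : IsCompact E)
    (hW : minEnergy α E < ⊤) : ∃ μ, IsEquilibriumMeasure α E μ := by
  -- The dummy quantifier gives `K` the shape of the tightness criterion, used with the constant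
  -- sequence of compact sets `E` and mass bounds `0`.
  let K : Set (ProbabilityMeasure (EuclideanSpace ℝ (Fin N))) := {μ | ∀ _ : ℕ, μ Eᶜ ≤ 0}
  have hK : IsCompact K :=
    isCompact_setOfPred_probabilityMeasure_mass_eq_compl_isCompact_le (u := fun _ => 0)
      (K := fun _ => E) tendsto_const_nhds (fun _ => hE) (Or.inl inferInstance)
  have hmem : ∀ μ : ProbabilityMeasure (EuclideanSpace ℝ (Fin N)),
      μ ∈ K ↔ (μ : Measure (EuclideanSpace ℝ (Fin N))) Eᶜ = 0 := by
    intro μ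
    simp [K, ProbabilityMeasure.null_iff_toMeasure_null]
  have hne : K.Nonempty := by
    rw [minEnergy, iInf_lt_iff] at hW
    obtain ⟨μ, hμ⟩ := hW
    obtain ⟨h1, hμ⟩ := iInf_lt_iff.1 hμ
    obtain ⟨h2, hμ⟩ := iInf_lt_iff.1 hμ
    exact ⟨⟨μ, h1⟩, (hmem _).2 h2⟩
  obtain ⟨μ, hμK, hμ⟩ :=
    ((lowerSemicontinuous_energy α).lowerSemicontinuousOn K).exists_isMinOn hne hK
  refine ⟨μ, inferInstance, (hmem μ).1 hμK,
    le_antisymm ?_ (minEnergy_le inferInstance ((hmem μ).1 hμK))⟩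
  refine le_iInf fun ν => le_iInf fun h1 => le_iInf fun h2 => ?_
  exact hμ ((hmem ⟨ν, h1⟩).2 h2)

/-! ### Variational conditions for the equilibrium measure. -/

/-- First-order condition at a minimum: `W` and `I` stand for the energies of two measures and `J`
for their mutual energy, and the right-hand side is the energy of a convex combination. -/
lemma le_of_forall_convex_combination {W J I : ℝ≥0∞} (hW : W < ⊤) (hI : I < ⊤)
    (h : ∀ a b : ℝ≥0, a + b = 1 → W ≤ a * (a * W + b * J) + b * (a * J + b * I)) : W ≤ J := by
  by_contra! hlt
  lift J to ℝ≥0 using (hlt.trans hW).ne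
  lift W to ℝ≥0 using hW.ne
  lift I to ℝ≥0 using hI.ne
  have hJW : J < W := by exact_mod_cast hlt
  set d : ℝ≥0 := W - J
  have hd : 0 < d := tsub_pos_of_lt hJW
  have hWd : W = J + d := (add_tsub_cancel_of_le hJW.le).symm
  have hpos : 0 < I + 2 * d := by positivity
  -- With `W = J + d` the hypothesis amounts to `2bd ≤ b²(I + d - J)`. The weight `b = d / (I + 2d)`
  -- is small enough that the right-hand side is at most `bd`.
  have h1 := h ((I + d) / (I + 2 * d)) (d / (I + 2 * d)) (by field_simp; ring)
  have h2 : W ≤ (I + d) / (I + 2 * d) * ((I + d) / (I + 2 * d) * W + d / (I + 2 * d) * J) +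
      d / (I + 2 * d) * ((I + d) / (I + 2 * d) * J + d / (I + 2 * d) * I) := by
    exact_mod_cast h1
  rw [hWd] at h2
  rw [← NNReal.coe_le_coe] at h2
  push_cast at h2
  have hd' : (0 : ℝ) < d := by exact_mod_cast hd
  have hI' : (0 : ℝ) ≤ I := I.2
  have hJ' : (0 : ℝ) ≤ J := J.2
  generalize (d : ℝ) = d at *
  generalize (I : ℝ) = i at *
  generalize (J : ℝ) = j at *
  field_simp at h2
  nlinarith [mul_pos hd' hd', mul_nonneg hI' hd'.le, mul_nonneg hJ' hd'.le,
    mul_pos (mul_pos hd' hd') hd', mul_nonneg (mul_nonneg hI' hd'.le) hd'.le,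
    mul_nonneg (mul_nonneg hJ' hd'.le) hd'.le]

/-- The variational inequality characterizing equilibrium measures. -/
lemma IsEquilibriumMeasure.minEnergy_le_lintegral_potential {E : Set (EuclideanSpace ℝ (Fin N))}
    {μ ν : Measure (EuclideanSpace ℝ (Fin N))} (hμ : IsEquilibriumMeasure α E μ)
    (hW : minEnergy α E < ⊤) (hν : IsProbabilityMeasure ν) (hνE : ν Eᶜ = 0)
    (hνe : energy α ν < ⊤) : minEnergy α E ≤ ∫⁻ x, potential α μ x ∂ν := by
  have := hμ.isProbabilityMeasure
  refine le_of_forall_convex_combination hW hνe fun a b hab => ?_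
  have hp : IsProbabilityMeasure ((a : ℝ≥0∞) • μ + (b : ℝ≥0∞) • ν) := by
    constructor
    simp only [Measure.coe_add, Measure.coe_smul, Pi.add_apply, Pi.smul_apply, measure_univ,
      smul_eq_mul, mul_one]
    exact_mod_cast hab
  refine (minEnergy_le (α := α) (E := E) hp (by simp [hμ.carried, hνE])).trans_eq ?_
  have hpot : ∀ x, potential α ((a : ℝ≥0∞) • μ + (b : ℝ≥0∞) • ν) x =
      a * potential α μ x + b * potential α ν x := by
    intro x
    simp only [potential, lintegral_add_measure, lintegral_smul_measure, smul_eq_mul]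
  have hI : ∀ ρ : Measure (EuclideanSpace ℝ (Fin N)),
      ∫⁻ x, potential α ((a : ℝ≥0∞) • μ + (b : ℝ≥0∞) • ν) x ∂ρ =
        a * ∫⁻ x, potential α μ x ∂ρ + b * ∫⁻ x, potential α ν x ∂ρ := by
    intro ρ
    simp_rw [hpot]
    rw [lintegral_add_left ((measurable_potential α μ).const_mul _),
      lintegral_const_mul _ (measurable_potential α μ),
      lintegral_const_mul _ (measurable_potential α ν)]
  rw [← hμ.energy_eq, energy, lintegral_add_measure, lintegral_smul_measure,
    lintegral_smul_measure, hI, hI, lintegral_potential_comm α ν μ]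
  rfl

/-- If the potential were below `W` on a set of positive measure, the normalized restriction of `μ`
to that set would violate the variational inequality. So the potential is at least `W` almost
everywhere, while its mean is exactly `W`. -/
lemma IsEquilibriumMeasure.ae_potential_eq {E : Set (EuclideanSpace ℝ (Fin N))}
    {μ : Measure (EuclideanSpace ℝ (Fin N))} (hμ : IsEquilibriumMeasure α E μ)
    (hW : minEnergy α E < ⊤) : ∀ᵐ x ∂μ, potential α μ x = minEnergy α E := by
  have := hμ.isProbabilityMeasure
  have hmeas := measurable_potential α μ
  have hfin : ∫⁻ x, potential α μ x ∂μ < ⊤ := hμ.energy_eq.trans_lt hW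
  set A := {x | potential α μ x < minEnergy α E} with hA
  have hAm : MeasurableSet A := hmeas measurableSet_Iio
  have hA0 : μ A = 0 := by
    by_contra hA0
    have hAtop : μ A ≠ ⊤ := measure_ne_top μ A
    have hinv : (μ A)⁻¹ ≠ ⊤ := ENNReal.inv_ne_top.2 hA0
    have hp : IsProbabilityMeasure ((μ A)⁻¹ • μ.restrict A) := by
      constructor
      simp [ENNReal.inv_mul_cancel hA0 hAtop]
    have he : energy α ((μ A)⁻¹ • μ.restrict A) < ⊤ := by
      have h1 : ∀ x, potential α ((μ A)⁻¹ • μ.restrict A) x ≤ (μ A)⁻¹ * potential α μ x := by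
        intro x
        simp only [potential, lintegral_smul_measure, smul_eq_mul]
        gcongr
        exact Measure.restrict_le_self
      calc energy α ((μ A)⁻¹ • μ.restrict A)
          ≤ ∫⁻ x, (μ A)⁻¹ * potential α μ x ∂((μ A)⁻¹ • μ.restrict A) := lintegral_mono h1
        _ = (μ A)⁻¹ * ((μ A)⁻¹ * ∫⁻ x in A, potential α μ x ∂μ) := by
            rw [lintegral_smul_measure, lintegral_const_mul _ hmeas, smul_eq_mul]
        _ ≤ (μ A)⁻¹ * ((μ A)⁻¹ * ∫⁻ x, potential α μ x ∂μ) := by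
            gcongr
            exact Measure.restrict_le_self
        _ < ⊤ := ENNReal.mul_lt_top hinv.lt_top (ENNReal.mul_lt_top hinv.lt_top hfin)
    have hle := hμ.minEnergy_le_lintegral_potential hW hp
      (by simp [le_antisymm ((Measure.restrict_le_self (s := A) Eᶜ).trans_eq hμ.carried) bot_le]) he
    refine hle.not_gt ?_
    rw [lintegral_smul_measure, smul_eq_mul]
    have hlt : ∫⁻ x in A, potential α μ x ∂μ < ∫⁻ _ in A, minEnergy α E ∂μ := by
      refine setLIntegral_strict_mono hAm hA0 measurable_const ?_ (ae_of_all _ fun x hx => hx)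
      exact ((lintegral_mono' Measure.restrict_le_self le_rfl).trans_lt hfin).ne
    rw [setLIntegral_const] at hlt
    calc (μ A)⁻¹ * ∫⁻ x in A, potential α μ x ∂μ < (μ A)⁻¹ * (minEnergy α E * μ A) := by
          exact ENNReal.mul_lt_mul_right (ENNReal.inv_ne_zero.2 hAtop) hinv hlt
      _ = minEnergy α E := by
          rw [mul_comm (minEnergy α E), ← mul_assoc, ENNReal.inv_mul_cancel hA0 hAtop, one_mul]
  have hge : (fun _ => minEnergy α E) ≤ᵐ[μ] potential α μ := by
    rw [EventuallyLE, ae_iff]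
    simpa [hA] using hA0
  refine (ae_eq_of_ae_le_of_lintegral_le hge ?_ hmeas.aemeasurable ?_).symm
  · simpa using hW.ne
  · rw [lintegral_const, measure_univ, mul_one]
    exact hμ.energy_eq.le

/-! ### Optimal centres and dominant sets. -/

lemma rpow_lt_kernel_of_edist_lt (hα : α < N) {r : ℝ≥0∞} {x y : EuclideanSpace ℝ (Fin N)}
    (h : edist x y < r) : r ^ (α - (N : ℝ)) < kernel α x y := by
  rw [kernel, ← neg_sub, ENNReal.rpow_neg, ENNReal.rpow_neg, ENNReal.inv_lt_inv]
  exact ENNReal.rpow_lt_rpow h (by linarith)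

lemma rpow_le_kernel_of_edist_le (hα : α < N) {r : ℝ≥0∞} {x y : EuclideanSpace ℝ (Fin N)}
    (h : edist x y ≤ r) : r ^ (α - (N : ℝ)) ≤ kernel α x y := by
  rw [kernel, ← neg_sub, ENNReal.rpow_neg, ENNReal.rpow_neg, ENNReal.inv_le_inv]
  exact ENNReal.rpow_le_rpow h (by linarith)

lemma edist_le_farthestDist {E : Set (EuclideanSpace ℝ (Fin N))} {t : EuclideanSpace ℝ (Fin N)}
    (ht : t ∈ E) (x : EuclideanSpace ℝ (Fin N)) : edist x t ≤ farthestDist E x :=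
  le_iSup₂_of_le t ht le_rfl

lemma continuous_iInf_kernel {ι X : Type*} [Finite ι] [TopologicalSpace X] (α : ℝ)
    {f : X → EuclideanSpace ℝ (Fin N)} {c : ι → X → EuclideanSpace ℝ (Fin N)}
    (hf : Continuous f) (hc : ∀ k, Continuous (c k)) :
    Continuous fun q => ⨅ k, kernel α (f q) (c k q) := by
  have := Fintype.ofFinite ι
  simp_rw [← Finset.inf_univ_eq_iInf]
  exact Continuous.finset_inf_apply fun k _ =>
    ENNReal.continuous_rpow_const.comp (hf.edist (hc k))

/-- The integrand is continuous in the centres, so by Fatou the integral is lower semicontinuous on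
a compact power of `E`. -/
lemma exists_isMinOn_lintegral_iInf_kernel {ι : Type*} [Finite ι]
    {E : Set (EuclideanSpace ℝ (Fin N))} (hE : IsCompact E) (hne : E.Nonempty)
    (μ : Measure (EuclideanSpace ℝ (Fin N))) :
    ∃ c : ι → E, ∀ c' : ι → E,
      ∫⁻ x, ⨅ k, kernel α x (c k) ∂μ ≤ ∫⁻ x, ⨅ k, kernel α x (c' k) ∂μ := by
  have := isCompact_iff_compactSpace.1 hE
  have := hne.to_subtype
  have hl : LowerSemicontinuous fun c : ι → E => ∫⁻ x, ⨅ k, kernel α x (c k) ∂μ := by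
    rw [lowerSemicontinuous_iff_le_liminf]
    intro c
    calc ∫⁻ x, ⨅ k, kernel α x (c k) ∂μ
        = ∫⁻ x, liminf (fun c' : ι → E => ⨅ k, kernel α x (c' k)) (𝓝 c) ∂μ := by
          refine lintegral_congr fun x => (Tendsto.liminf_eq ?_).symm
          exact (continuous_iInf_kernel α continuous_const fun k =>
            continuous_subtype_val.comp (continuous_apply k)).tendsto c
      _ ≤ _ := lintegral_liminf_le fun c' =>
          (continuous_iInf_kernel α continuous_id fun k => continuous_const).measurable
  obtain ⟨c, -, hc⟩ := (hl.lowerSemicontinuousOn univ).exists_isMinOn univ_nonempty isCompact_univ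
  exact ⟨c, fun c' => hc (mem_univ c')⟩

/-- The set where some point of `E` is farther than every centre is open. Being null, it misses the
support, which upgrades an almost-everywhere identity to every point of the support. -/
lemma isDominant_range_of_measure_eq_zero {ι : Type*} [Finite ι] [Nonempty ι]
    {E : Set (EuclideanSpace ℝ (Fin N))} {μ : Measure (EuclideanSpace ℝ (Fin N))}
    {c : ι → EuclideanSpace ℝ (Fin N)} (hc : ∀ k, c k ∈ E)
    (h : μ {x | ∃ t ∈ E, ∀ k, edist x (c k) < edist x t} = 0) :
    IsDominant E μ (range c) := by
  refine ⟨(finite_range c).isClosed, range_subset_iff.2 hc, fun x hx => ?_⟩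
  have hopen : IsOpen {x | ∃ t ∈ E, ∀ k, edist x (c k) < edist x t} := by
    have : {x | ∃ t ∈ E, ∀ k, edist x (c k) < edist x t} =
        ⋃ t ∈ E, ⋂ k, {x | edist x (c k) < edist x t} := by
      ext x; simp
    rw [this]
    exact isOpen_biUnion fun t _ => isOpen_iInter_of_finite fun k =>
      isOpen_lt (by fun_prop) (by fun_prop)
  have hx' : ∀ t ∈ E, ∃ k, edist x t ≤ edist x (c k) := by
    have := fun hmem => Measure.subset_compl_support_of_isOpen hopen h hmem hx
    simpa using this
  obtain ⟨k, hk⟩ := Finite.exists_max fun k => edist x (c k)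
  have hmax : farthestDist E x = edist x (c k) := by
    refine le_antisymm (iSup₂_le fun t ht => ?_) (edist_le_farthestDist (hc k) x)
    obtain ⟨j, hj⟩ := hx' t ht
    exact hj.trans (hk j)
  refine ⟨⟨c k, mem_range_self k, hmax.symm⟩, ?_⟩
  rintro _ ⟨_, ⟨j, rfl⟩, rfl⟩
  exact edist_le_farthestDist (hc j) x

theorem const_lt_constFin (hα : α < N) {E : Set (EuclideanSpace ℝ (Fin N))} (hE : IsCompact E)
    {μ : Measure (EuclideanSpace ℝ (Fin N))} (hμ : IsEquilibriumMeasure α E μ)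
    (hW : minEnergy α E < ⊤) (hinf : ∀ S, IsDominant E μ S → S.Infinite) {m : ℕ} (hm : m ≠ 0) :
    const α E μ < constFin α E μ m := by
  have := hμ.isProbabilityMeasure
  have : Nonempty (Fin m) := Fin.pos_iff_nonempty.1 (Nat.pos_of_ne_zero hm)
  obtain ⟨x₀, hx₀E, hx₀⟩ : ∃ x ∈ E, potential α μ x < ⊤ := by
    have h1 : ∀ᵐ x ∂μ, x ∈ E := by
      rw [ae_iff]; exact hμ.carried
    obtain ⟨x, h, h'⟩ := (h1.and (hμ.ae_potential_eq hW)).exists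
    exact ⟨x, h, h' ▸ hW⟩
  obtain ⟨c, hc⟩ := exists_isMinOn_lintegral_iInf_kernel (α := α) (ι := Fin m) hE ⟨x₀, hx₀E⟩ μ
  have hmin : (⨅ c : Fin m → E, ∫⁻ x, ⨅ k : Fin m, kernel α x (c k) ∂μ) =
      ∫⁻ x, ⨅ k, kernel α x (c k) ∂μ := le_antisymm (iInf_le _ c) (le_iInf hc)
  -- Placing all centres at `x₀` yields the potential at `x₀`, which is finite; without finiteness
  -- `toReal` would not preserve the strict inequality.
  have hfin : ∫⁻ x, ⨅ k, kernel α x (c k) ∂μ < ⊤ := by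
    refine (hc fun _ => ⟨x₀, hx₀E⟩).trans_lt (lt_of_le_of_lt ?_ hx₀)
    simp only [ciInf_const, potential, kernel_comm α _ x₀, le_refl]
  have hle : ∀ x, farthestDist E x ^ (α - (N : ℝ)) ≤ ⨅ k, kernel α x (c k) := fun x =>
    le_iInf fun k => rpow_le_kernel_of_edist_le hα (edist_le_farthestDist (c k).2 x)
  have hlt : ∫⁻ x, farthestDist E x ^ (α - (N : ℝ)) ∂μ < ∫⁻ x, ⨅ k, kernel α x (c k) ∂μ := by
    by_contra! hge
    have hae := ae_eq_of_ae_le_of_lintegral_le (ae_of_all μ hle)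
      ((lintegral_mono hle).trans_lt hfin).ne
      (Measurable.iInf fun k => (continuous_kernel_left α _).measurable).aemeasurable hge
    refine hinf _ (isDominant_range_of_measure_eq_zero (c := fun k => (c k : EuclideanSpace ℝ _))
      (fun k => (c k).2) (measure_mono_null ?_ (ae_iff.1 hae))) (finite_range _)
    rintro x ⟨t, ht, hxt⟩
    obtain ⟨k, hk⟩ := exists_eq_ciInf_of_finite (f := fun k => kernel α x (c k))
    refine ne_of_lt (lt_of_lt_of_eq (rpow_lt_kernel_of_edist_lt hα ?_) hk)
    exact (hxt k).trans_le (edist_le_farthestDist ht x)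
  rw [const, constFin, hmin]
  exact sub_lt_sub_right ((ENNReal.toReal_lt_toReal (hlt.trans hfin).ne hfin.ne).2 hlt) _

/-! ### Measures of finite energy do not charge lines. -/

/-- A finite measure on the line is zero where its Riesz potential of order at least one is
finite. -/
lemma measure_real_eq_zero_of_lintegral_rpow_lt_top {s : ℝ} (hs : 1 ≤ s) {ρ : Measure ℝ}
    [IsFiniteMeasure ρ] {A : Set ℝ} (hA : ∀ x ∈ A, ∫⁻ y, edist x y ^ (-s) ∂ρ < ⊤) :
    ρ A = 0 := by
  -- Finiteness of the integral excludes an atom at `x`, so the integral over the ball of radius `r`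
  -- tends to `0`. The integrand is at least `r ^ (-s)` there, so the ball has mass `o(r ^ s)`,
  -- hence `o(r)` because `s ≥ 1`.
  have key : ∀ x ∈ A, ∀ ε : ℝ≥0, 0 < ε → ∀ᶠ r : ℝ in 𝓝[>] 0,
      ρ (Metric.closedBall x r) ≤ (ε • (volume : Measure ℝ)) (Metric.closedBall x r) := by
    intro x hx ε hε
    have h0 : ρ {x} = 0 := by
      by_contra h
      have : ∫⁻ y in {x}, edist x y ^ (-s) ∂ρ = ⊤ := by
        rw [lintegral_singleton, edist_self, ENNReal.zero_rpow_of_neg (by linarith)]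
        exact ENNReal.top_mul h
      have h2 := lintegral_mono' (μ := ρ.restrict {x}) Measure.restrict_le_self
        (le_refl fun y => edist x y ^ (-s))
      rw [this] at h2
      exact absurd (hA x hx) (by simpa using h2)
    have htend : Tendsto (fun r : ℝ => ρ (Metric.closedBall x r)) (𝓝[>] 0) (𝓝 0) := by
      have := tendsto_measure_biInter_gt (μ := ρ) (a := (0 : ℝ))
        (s := fun r => Metric.closedBall x r)
        (fun r _ => measurableSet_closedBall.nullMeasurableSet)
        (fun i j _ hij => Metric.closedBall_subset_closedBall hij)
        ⟨1, one_pos, measure_ne_top _ _⟩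
      have hI : ⋂ r > (0 : ℝ), Metric.closedBall x r = {x} := by
        ext y
        simp only [gt_iff_lt, mem_iInter, Metric.mem_closedBall, mem_singleton_iff]
        exact ⟨fun h => dist_le_zero.1 (le_of_forall_pos_le_add fun e he => by simpa using h e he),
          fun h r hr => by simp [h, hr.le]⟩
      rwa [hI, h0] at this
    have h1 := tendsto_setLIntegral_zero (hA x hx).ne htend
    filter_upwards [h1.eventually (gt_mem_nhds (ENNReal.coe_pos.2 hε)),
      Ioc_mem_nhdsGT one_pos] with r hr hr1
    have hr0 : 0 < r := hr1.1
    have hball : ∀ y ∈ Metric.closedBall x r, ENNReal.ofReal r ^ (-s) ≤ edist x y ^ (-s) := by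
      intro y hy
      rw [ENNReal.rpow_neg, ENNReal.rpow_neg, ENNReal.inv_le_inv]
      refine ENNReal.rpow_le_rpow ?_ (by linarith)
      rw [edist_comm, edist_dist]
      exact ENNReal.ofReal_le_ofReal hy
    have h3 : ENNReal.ofReal r ^ (-s) * ρ (Metric.closedBall x r) ≤ ε := by
      rw [← setLIntegral_const]
      exact (setLIntegral_mono' measurableSet_closedBall hball).trans hr.le
    have hrs : ENNReal.ofReal r ^ s ≤ ENNReal.ofReal r := by
      refine (ENNReal.rpow_le_rpow_of_exponent_ge (by simpa using hr1.2) hs).trans_eq ?_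
      exact ENNReal.rpow_one _
    have hne0 : ENNReal.ofReal r ^ s ≠ 0 := (ENNReal.rpow_pos (by simpa using hr0) (by simp)).ne'
    have hnet : ENNReal.ofReal r ^ s ≠ ⊤ := (hrs.trans_lt ENNReal.ofReal_lt_top).ne
    rw [ENNReal.rpow_neg] at h3
    calc ρ (Metric.closedBall x r)
        = ENNReal.ofReal r ^ s * ((ENNReal.ofReal r ^ s)⁻¹ * ρ (Metric.closedBall x r)) := by
          rw [← mul_assoc, ENNReal.mul_inv_cancel hne0 hnet, one_mul]
      _ ≤ ENNReal.ofReal (2 * r) * ε := by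
          gcongr
          exact hrs.trans (ENNReal.ofReal_le_ofReal (by linarith))
      _ = _ := by
          rw [Measure.smul_apply, Real.volume_closedBall, mul_comm]
          rfl
  have hbdd : ∀ n : ℕ, ρ (A ∩ Metric.closedBall 0 n) = 0 := by
    intro n
    have hle : ∀ ε : ℝ≥0, 0 < ε →
        ρ (A ∩ Metric.closedBall 0 n) ≤ ε * volume (Metric.closedBall (0 : ℝ) n) := by
      intro ε hε
      -- The Besicovitch covering theorem turns the density bound into `ρ ≤ ε • volume` on a bounded
      -- part of `A`, where `ε` can tend to `0`.
      have := (Besicovitch.vitaliFamily ρ).measure_le_of_frequently_le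
        (ε • (volume : Measure ℝ)) (ρ := ρ) Measure.AbsolutelyContinuous.rfl
        (A ∩ Metric.closedBall 0 n) fun x hx =>
          (Besicovitch.tendsto_filterAt ρ x).frequently (key x hx.1 ε hε).frequently
      refine this.trans ?_
      rw [Measure.smul_apply]
      exact mul_le_mul' le_rfl (measure_mono inter_subset_right)
    have hV : volume (Metric.closedBall (0 : ℝ) n) ≠ ⊤ := measure_closedBall_lt_top.ne
    by_contra hne
    have hlim : Tendsto (fun ε : ℝ≥0 => (ε : ℝ≥0∞) * volume (Metric.closedBall (0 : ℝ) n))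
        (𝓝[>] 0) (𝓝 0) := by
      have h1 : Tendsto (fun ε : ℝ≥0 => (ε : ℝ≥0∞)) (𝓝[>] 0) (𝓝 0) :=
        (ENNReal.continuous_coe.tendsto' 0 0 rfl).mono_left nhdsWithin_le_nhds
      simpa using ENNReal.Tendsto.mul_const h1 (Or.inr hV)
    exact hne (le_antisymm (ge_of_tendsto hlim (by
      filter_upwards [self_mem_nhdsWithin] with ε hε using hle ε hε)) bot_le)
  refine measure_mono_null (t := ⋃ n : ℕ, A ∩ Metric.closedBall 0 n) ?_ (measure_iUnion_null hbdd)
  intro x hx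
  obtain ⟨n, hn⟩ := exists_nat_ge ‖x‖
  exact mem_iUnion.2 ⟨n, hx, by simpa using hn⟩

/-- A measure of finite energy does not charge lines when `1 ≤ N - α`. -/
theorem measure_line_eq_zero (hα : α ≤ N - 1) {μ : Measure (EuclideanSpace ℝ (Fin N))}
    [IsFiniteMeasure μ] (he : energy α μ < ⊤) (t v : EuclideanSpace ℝ (Fin N)) :
    μ {x | x - t ∈ Submodule.span ℝ {v}} = 0 := by
  set ℓ := {x | x - t ∈ Submodule.span ℝ {v}}
  have hfin : ∀ᵐ x ∂μ, potential α μ x < ⊤ := ae_lt_top (measurable_potential α μ) he.ne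
  -- The coordinate along the line is isometric on it, so the energy estimate transfers to a measure
  -- on `ℝ` with exponent `N - α ≥ 1`.
  obtain ⟨φ, hφ, hφc⟩ : ∃ φ : EuclideanSpace ℝ (Fin N) → ℝ,
      (∀ x ∈ ℓ, ∀ y ∈ ℓ, edist (φ x) (φ y) = edist x y) ∧ Continuous φ := by
    refine ⟨fun x => inner ℝ (‖v‖⁻¹ • v) x, ?_, by fun_prop⟩
    intro x hx y hy
    obtain ⟨a, ha⟩ := Submodule.mem_span_singleton.1 hx
    obtain ⟨b, hb⟩ := Submodule.mem_span_singleton.1 hy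
    have hxy : x - y = (a - b) • v := by
      rw [sub_smul, ha, hb]; abel
    rcases eq_or_ne v 0 with hv | hv
    · rw [hv, smul_zero, sub_eq_zero] at hxy
      simp [hxy]
    have hn : ‖v‖ ≠ 0 := norm_ne_zero_iff.2 hv
    rw [edist_dist, edist_dist, dist_eq_norm, dist_eq_norm, ← inner_sub_right, hxy,
      inner_smul_left, inner_smul_right, real_inner_self_eq_norm_sq, norm_smul]
    congr 1
    simp
    field_simp
  have hclosed : IsClosed ℓ :=
    (Submodule.closed_of_finiteDimensional (Submodule.span ℝ {v})).preimage (continuous_sub_right t)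
  have hℓ : MeasurableSet ℓ := hclosed.measurableSet
  set ρ := (μ.restrict ℓ).map φ
  have hA := measure_real_eq_zero_of_lintegral_rpow_lt_top (s := N - α) (by linarith) (ρ := ρ)
    (A := {x | ∫⁻ y, edist x y ^ (-((N : ℝ) - α)) ∂ρ < ⊤}) (fun x hx => hx)
  have hAm : MeasurableSet {x : ℝ | ∫⁻ y, edist x y ^ (-((N : ℝ) - α)) ∂ρ < ⊤} := by
    refine (Measurable.lintegral_prod_right' (f := fun p : ℝ × ℝ =>
      edist p.1 p.2 ^ (-((N : ℝ) - α))) ?_) measurableSet_Iio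
    exact (ENNReal.continuous_rpow_const.comp (continuous_fst.edist continuous_snd)).measurable
  rw [Measure.map_apply hφc.measurable hAm, Measure.restrict_apply (hφc.measurable hAm)] at hA
  have hae : ∀ᵐ x ∂μ, x ∉ ℓ := by
    have hA' : ∀ᵐ x ∂μ, ¬ (x ∈ φ ⁻¹' {x | ∫⁻ y, edist x y ^ (-((N : ℝ) - α)) ∂ρ < ⊤} ∩ ℓ) := by
      rw [ae_iff]; simpa only [not_not] using! hA
    filter_upwards [hA', hfin] with x hx hxf hxℓ
    refine hx ⟨?_, hxℓ⟩
    simp only [mem_preimage, mem_ofPred_eq]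
    rw [lintegral_map (by exact (ENNReal.continuous_rpow_const.comp
      (continuous_const.edist continuous_id)).measurable) hφc.measurable]
    refine lt_of_le_of_lt ?_ hxf
    calc ∫⁻ y in ℓ, edist (φ x) (φ y) ^ (-((N : ℝ) - α)) ∂μ
        = ∫⁻ y in ℓ, kernel α x y ∂μ := by
          refine setLIntegral_congr_fun hℓ fun y hy => ?_
          simp only [kernel, hφ x hxℓ y hy, neg_sub]
      _ ≤ _ := lintegral_mono' Measure.restrict_le_self le_rfl
  simpa [ae_iff] using hae

/-! ### Farthest points and normal lines. -/

/-- From an interior point one could move slightly away from `x` and stay in `E`; if `t = x`, any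
direction does. -/
lemma mem_frontier_of_forall_dist_le [NeZero N] {E : Set (EuclideanSpace ℝ (Fin N))}
    {x t : EuclideanSpace ℝ (Fin N)} (ht : t ∈ E) (hmax : ∀ y ∈ E, dist x y ≤ dist x t) :
    t ∈ frontier E := by
  refine ⟨subset_closure ht, fun hint => ?_⟩
  obtain ⟨u, hu, hut⟩ : ∃ u : EuclideanSpace ℝ (Fin N), u ≠ 0 ∧ ∃ c : ℝ, 0 ≤ c ∧ t - x = c • u := by
    by_cases h : t - x = 0
    · obtain ⟨u, hu⟩ := exists_ne (0 : EuclideanSpace ℝ (Fin N))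
      exact ⟨u, hu, 0, le_rfl, by simp [h]⟩
    · exact ⟨t - x, h, 1, zero_le_one, (one_smul _ _).symm⟩
  obtain ⟨c, hc, hcu⟩ := hut
  have hcont : Tendsto (fun s : ℝ => t + s • u) (𝓝[>] 0) (𝓝 t) := by
    have : Continuous fun s : ℝ => t + s • u := by fun_prop
    exact (this.tendsto' 0 t (by simp)).mono_left nhdsWithin_le_nhds
  obtain ⟨s, hsE, hs⟩ := ((hcont.eventually (mem_interior_iff_mem_nhds.1 hint)).and
    self_mem_nhdsWithin).exists
  have hs0 : (0 : ℝ) < s := hs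
  have h1 := hmax _ hsE
  have h2 : t + s • u - x = (c + s) • u := by
    rw [add_smul, ← hcu]; abel
  rw [dist_comm, dist_comm x, dist_eq_norm, dist_eq_norm, h2, hcu, norm_smul, norm_smul,
    Real.norm_of_nonneg hc, Real.norm_of_nonneg (by linarith)] at h1
  nlinarith [norm_pos_iff.2 hu]

/-- At a farthest point the position vector is normal to the level set of a defining function. -/
lemma exists_smul_fderiv_eq_inner {F : Set (EuclideanSpace ℝ (Fin N))}
    {x t : EuclideanSpace ℝ (Fin N)} {U : Set (EuclideanSpace ℝ (Fin N))}
    {g : EuclideanSpace ℝ (Fin N) → ℝ} (hU : U ∈ 𝓝 t) (hg : ContDiffAt ℝ 1 g t)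
    (hg0 : fderiv ℝ g t ≠ 0) (ht : t ∈ F) (hF : F ∩ U = {x ∈ U | g x = 0})
    (hmax : ∀ y ∈ F, dist x y ≤ dist x t) :
    ∃ c : ℝ, ∀ v, inner ℝ (t - x) v = c * fderiv ℝ g t v := by
  have hgt : g t = 0 := by
    have : t ∈ F ∩ U := ⟨ht, mem_of_mem_nhds hU⟩
    rw [hF] at this
    exact this.2
  have hext : IsLocalExtrOn (fun y => ‖y - x‖ ^ 2) {y | g y = g t} t := by
    right
    filter_upwards [self_mem_nhdsWithin, mem_nhdsWithin_of_mem_nhds hU] with y hy hyU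
    have hyF : y ∈ F ∩ U := by
      rw [hF]; exact ⟨hyU, by rw [← hgt]; exact hy⟩
    have := hmax y hyF.1
    rw [dist_comm, dist_comm x, dist_eq_norm, dist_eq_norm] at this
    gcongr
  have hφ : HasStrictFDerivAt (fun y : EuclideanSpace ℝ (Fin N) => ‖y - x‖ ^ 2)
      (2 • innerSL ℝ (t - x)) t := by
    have := (hasStrictFDerivAt_norm_sq (t - x)).comp t
      ((hasStrictFDerivAt_id t).sub_const x)
    simpa using! this
  obtain ⟨a, b, hab, h⟩ := hext.exists_multipliers_of_hasStrictFDerivAt_1d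
    (hg.hasStrictFDerivAt one_ne_zero) hφ
  have hb : b ≠ 0 := by
    rintro rfl
    rw [zero_smul, add_zero] at h
    rcases smul_eq_zero.1 h with h | h
    · exact hab (by simp [h])
    · exact hg0 h
  refine ⟨-a / (2 * b), fun v => ?_⟩
  have := congrArg (fun l : StrongDual ℝ (EuclideanSpace ℝ (Fin N)) => l v) h
  simp only [add_apply, smul_apply, innerSL_apply_apply,
    smul_eq_mul, nsmul_eq_mul, zero_apply] at this
  push_cast at this
  field_simp
  linarith

/-- Points whose farthest point in `E` is `t` lie on the normal line of the boundary at `t`. -/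
lemma exists_normal_line [NeZero N] {E : Set (EuclideanSpace ℝ (Fin N))} (hE : IsCompact E)
    (hbd : HasC1Boundary E) {t : EuclideanSpace ℝ (Fin N)} (ht : t ∈ E) :
    ∃ v, ∀ x, (∀ y ∈ E, dist x y ≤ dist x t) → x - t ∈ Submodule.span ℝ {v} := by
  by_cases htf : t ∈ frontier E
  · obtain ⟨U, g, hU, htU, hg, hg0, hF⟩ := hbd t htf
    refine ⟨(InnerProductSpace.toDual ℝ _).symm (fderiv ℝ g t), fun x hx => ?_⟩
    obtain ⟨c, hc⟩ := exists_smul_fderiv_eq_inner (hU.mem_nhds htU)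
      (hg.contDiffAt (hU.mem_nhds htU)) hg0 htf hF
      (fun y hy => hx y (hE.isClosed.frontier_subset hy))
    refine Submodule.mem_span_singleton.2 ⟨-c, ?_⟩
    refine ext_inner_right ℝ fun v => ?_
    rw [inner_smul_left, InnerProductSpace.toDual_symm_apply, ← neg_sub, inner_neg_left, hc]
    simp
  · exact ⟨0, fun x hx => absurd (mem_frontier_of_forall_dist_le ht hx) htf⟩

lemma IsDominant.exists_lines [NeZero N] {E S : Set (EuclideanSpace ℝ (Fin N))}
    {μ : Measure (EuclideanSpace ℝ (Fin N))} (hE : IsCompact E) (hbd : HasC1Boundary E)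
    (hS : IsDominant E μ S) :
    ∃ v : EuclideanSpace ℝ (Fin N) → EuclideanSpace ℝ (Fin N),
      μ.support ⊆ ⋃ t ∈ S, {x | x - t ∈ Submodule.span ℝ {v t}} := by
  have h : ∀ t, ∃ v, t ∈ E → ∀ x, (∀ y ∈ E, dist x y ≤ dist x t) →
      x - t ∈ Submodule.span ℝ {v} := by
    intro t
    by_cases ht : t ∈ E
    · obtain ⟨v, hv⟩ := exists_normal_line hE hbd ht
      exact ⟨v, fun _ => hv⟩
    · exact ⟨0, fun h => absurd h ht⟩
  choose v hv using h
  refine ⟨v, fun x hx => ?_⟩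
  obtain ⟨t, htS, ht⟩ := (hS.isGreatest x hx).1
  refine mem_iUnion₂.2 ⟨t, htS, hv t (hS.subset htS) x fun y hy => ?_⟩
  have : edist x y ≤ edist x t := (edist_le_farthestDist hy x).trans_eq ht.symm
  rwa [edist_dist, edist_dist, ENNReal.ofReal_le_ofReal_iff dist_nonneg] at this

/-! ### Boundary arcs off the lines, and measures of finite energy on them. -/

/-- A level set of a `C^1` function contains a curve with prescribed tangent direction in the
kernel of the differential. -/
lemma exists_curve_hasStrictDerivAt {U : Set (EuclideanSpace ℝ (Fin N))}
    {g : EuclideanSpace ℝ (Fin N) → ℝ} {p τ : EuclideanSpace ℝ (Fin N)}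
    (hU : U ∈ 𝓝 p) (hg : ContDiffAt ℝ 1 g p) (hg0 : fderiv ℝ g p ≠ 0) (hτ : fderiv ℝ g p τ = 0) :
    ∃ γ : ℝ → EuclideanSpace ℝ (Fin N), γ 0 = p ∧ HasStrictDerivAt γ τ 0 ∧
      ∀ᶠ s in 𝓝 0, γ s ∈ U ∧ g (γ s) = g p := by
  have hstrict := hg.hasStrictFDerivAt one_ne_zero
  have hrange : (fderiv ℝ g p).range = ⊤ := by
    refine LinearMap.range_eq_top.2 (LinearMap.surjective ?_)
    intro h
    exact hg0 (by ext v; simpa using congrArg (fun l => l v) h)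
  set ψ := hstrict.implicitFunction g (fderiv ℝ g p) hrange (g p)
  let τ' : (fderiv ℝ g p).ker := ⟨τ, hτ⟩
  have hψ := hstrict.to_implicitFunction hrange
  have hlin : HasStrictDerivAt (fun s : ℝ => s • τ') τ' 0 := by
    simpa using (hasStrictDerivAt_id (0 : ℝ)).smul_const τ'
  have hψ0 : ψ 0 = p := hstrict.implicitFunction_apply_image hrange
  have hder : HasStrictDerivAt (fun s : ℝ => ψ (s • τ')) τ 0 := by
    have h0 : HasStrictFDerivAt ψ (fderiv ℝ g p).ker.subtypeL ((0 : ℝ) • τ') := by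
      rw [zero_smul]; exact hψ
    simpa using! h0.comp_hasStrictDerivAt (0 : ℝ) hlin
  refine ⟨fun s => ψ (s • τ'), by simp [hψ0], hder, ?_⟩
  have hc : ContinuousAt (fun s : ℝ => ψ (s • τ')) 0 := hder.hasDerivAt.continuousAt
  have h1 : ∀ᶠ s : ℝ in 𝓝 0, ψ (s • τ') ∈ U :=
    hc.eventually_mem (by simpa [hψ0] using hU)
  have h2 : Tendsto (fun s : ℝ => (g p, s • τ')) (𝓝 0) (𝓝 (g p, 0)) := by
    have : Continuous fun s : ℝ => (g p, s • τ') := by fun_prop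
    exact this.tendsto' _ _ (by simp)
  exact h1.and (h2.eventually (hstrict.map_implicitFunction_eq hrange))

/-- The boundary contains an arc, bi-Lipschitz over an interval, which avoids a given finite
family of lines. -/
theorem exists_arc_avoiding_lines (hN : 2 ≤ N) {E S : Set (EuclideanSpace ℝ (Fin N))}
    (hE : IsCompact E) (hne : E.Nonempty) (hbd : HasC1Boundary E) (hS : S.Finite)
    (v : EuclideanSpace ℝ (Fin N) → EuclideanSpace ℝ (Fin N)) :
    ∃ (γ : ℝ → EuclideanSpace ℝ (Fin N)) (δ c : ℝ), 0 < δ ∧ 0 < c ∧ ContinuousOn γ (Ioo 0 δ) ∧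
      (∀ s ∈ Ioo 0 δ, γ s ∈ E ∧ ∀ t ∈ S, γ s - t ∉ Submodule.span ℝ {v t}) ∧
      ∀ s ∈ Ioo 0 δ, ∀ s' ∈ Ioo 0 δ, c * dist s s' ≤ dist (γ s) (γ s') := by
  have : NeZero N := ⟨by omega⟩
  obtain ⟨y, hy⟩ : ∃ y, y ∉ E := by
    by_contra! h
    exact noncompact_univ (EuclideanSpace ℝ (Fin N)) (eq_univ_of_forall h ▸ hE)
  -- The arc starts at a point `p` of `E` farthest from `y`: there `E` lies in a ball touching it at
  -- `p`, so the boundary cannot contain points of a tangent line through `p` other than `p`.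
  obtain ⟨p, hpE, hp⟩ := hE.exists_isMaxOn hne
    (continuous_const.dist continuous_id : Continuous fun z => dist y z).continuousOn
  have hp' : ∀ z ∈ E, dist y z ≤ dist y p := fun z hz => hp hz
  have hpf := mem_frontier_of_forall_dist_le hpE hp'
  obtain ⟨U, g, hU, hpU, hg, hg0, hF⟩ := hbd p hpf
  have hUn := hU.mem_nhds hpU
  obtain ⟨a, ha⟩ := exists_smul_fderiv_eq_inner hUn (hg.contDiffAt hUn) hg0 hpf hF
      (fun z hz => hp' z (hE.isClosed.frontier_subset hz))
  obtain ⟨τ, hτ, hτ0⟩ : ∃ τ, fderiv ℝ g p τ = 0 ∧ τ ≠ 0 := by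
    have : (fderiv ℝ g p : EuclideanSpace ℝ (Fin N) →ₗ[ℝ] ℝ).ker ≠ ⊥ :=
      LinearMap.ker_ne_bot_of_finrank_lt (by simp; omega)
    obtain ⟨τ, hτ, h0⟩ := (Submodule.ne_bot_iff _).1 this
    exact ⟨τ, hτ, h0⟩
  obtain ⟨γ, hγ0, hγ, hγU⟩ := exists_curve_hasStrictDerivAt hUn (hg.contDiffAt hUn) hg0 hτ
  have hgp : g p = 0 := by
    have : p ∈ frontier E ∩ U := ⟨hpf, hpU⟩
    rw [hF] at this
    exact this.2
  have hγE : ∀ᶠ s in 𝓝 0, γ s ∈ E := by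
    filter_upwards [hγU] with s hs
    have : γ s ∈ frontier E ∩ U := by
      rw [hF]; exact ⟨hs.1, hs.2.trans hgp⟩
    exact hE.isClosed.frontier_subset this.1
  have hτn : 0 < ‖τ‖ := norm_pos_iff.2 hτ0
  -- the strict derivative gives two-sided Lipschitz bounds
  obtain ⟨s₁, hs₁, hanti⟩ : ∃ s₁ ∈ 𝓝 (0 : ℝ), ∀ s ∈ s₁, ∀ s' ∈ s₁,
      ‖τ‖ / 2 * dist s s' ≤ dist (γ s) (γ s') := by
    have hlo := hγ.hasStrictFDerivAt.isLittleO.def (half_pos hτn)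
    rw [nhds_prod_eq, eventually_prod_self_iff'] at hlo
    obtain ⟨s₁, hs₁, h⟩ := hlo
    refine ⟨s₁, hs₁, fun s hs s' hs' => ?_⟩
    have h1 := h s hs s' hs'
    simp only [ContinuousLinearMap.toSpanSingleton_apply] at h1
    have h2 := norm_sub_norm_le ((s - s') • τ) (γ s - γ s')
    rw [norm_sub_rev ((s - s') • τ), norm_smul] at h2
    rw [dist_eq_norm, dist_eq_norm]
    linarith
  obtain ⟨K, s₂, hs₂, hlip⟩ := hγ.hasStrictFDerivAt.exists_lipschitzOnWith
  -- A line met by the arc at parameters tending to `0` contains `p` and, by taking limits of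
  -- secants, has direction `τ`: it is tangent at `p`.
  have hline : ∀ t ∈ S, ∀ᶠ s in 𝓝[>] (0 : ℝ), γ s - t ∉ Submodule.span ℝ {v t} := by
    intro t _
    by_contra hcon
    have hfr : ∃ᶠ s in 𝓝[>] (0 : ℝ), γ s - t ∈ Submodule.span ℝ {v t} := by
      simpa [Filter.not_eventually] using hcon
    have hcl : IsClosed (Submodule.span ℝ {v t} : Set (EuclideanSpace ℝ (Fin N))) :=
      Submodule.closed_of_finiteDimensional _
    have hpt : p - t ∈ Submodule.span ℝ {v t} := by
      have hc : Tendsto (fun s => γ s - t) (𝓝[>] (0 : ℝ)) (𝓝 (p - t)) := by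
        have := hγ.hasDerivAt.continuousAt.tendsto.sub_const t
        rw [hγ0] at this
        exact this.mono_left nhdsWithin_le_nhds
      exact hcl.mem_of_frequently_of_tendsto hfr hc
    have hfr' : ∃ᶠ s in 𝓝[>] (0 : ℝ), γ s - p ∈ Submodule.span ℝ {v t} :=
      hfr.mono fun s hs => by
        have := Submodule.sub_mem _ hs hpt
        simpa using this
    have hτt : τ ∈ Submodule.span ℝ {v t} := by
      have hc : Tendsto (fun s : ℝ => s⁻¹ • (γ s - p)) (𝓝[>] 0) (𝓝 τ) := by
        have := hγ.hasDerivAt.tendsto_slope_zero_right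
        simpa [hγ0] using this
      exact hcl.mem_of_frequently_of_tendsto (hfr'.mono fun s hs => Submodule.smul_mem _ _ hs) hc
    have hspan : Submodule.span ℝ {v t} ≤ Submodule.span ℝ {τ} := by
      obtain ⟨b, hb⟩ := Submodule.mem_span_singleton.1 hτt
      have hb0 : b ≠ 0 := by
        rintro rfl
        exact hτ0 (by simpa using hb.symm)
      rw [Submodule.span_singleton_le_iff_mem]
      exact Submodule.mem_span_singleton.2
        ⟨b⁻¹, by rw [← hb, smul_smul, inv_mul_cancel₀ hb0, one_smul]⟩
    obtain ⟨s, hs, ⟨hsE, hs1⟩, hs0⟩ := (hfr'.and_eventually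
      ((((hγE.and (eventually_mem_set.2 hs₁)).filter_mono nhdsWithin_le_nhds)).and
        self_mem_nhdsWithin)).exists
    obtain ⟨b, hb⟩ := Submodule.mem_span_singleton.1 (hspan hs)
    have hs0' : (0 : ℝ) < s := hs0
    have h1 := hanti s hs1 0 (mem_of_mem_nhds hs₁)
    rw [hγ0, dist_eq_norm (γ s), ← hb, Real.dist_eq, sub_zero, abs_of_pos hs0'] at h1
    have hpos : 0 < ‖b • τ‖ := lt_of_lt_of_le (by positivity) h1
    have h2 := hp' (γ s) hsE
    rw [dist_comm, dist_comm y, dist_eq_norm, dist_eq_norm] at h2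
    have h3 : γ s - y = (p - y) + b • τ := by rw [hb]; abel
    -- Since `p - y` is normal and `τ` tangent, Pythagoras makes `γ s` strictly farther from `y`
    -- than `p`, a contradiction.
    have h4 : inner ℝ (p - y) (b • τ) = 0 := by
      rw [inner_smul_right, ha, hτ]; simp
    have h5 := norm_add_sq_real (p - y) (b • τ)
    rw [← h3, h4] at h5
    nlinarith [norm_nonneg (γ s - y), norm_nonneg (p - y)]
  have hall : ∀ᶠ s in 𝓝[>] (0 : ℝ), (∀ t ∈ S, γ s - t ∉ Submodule.span ℝ {v t}) ∧
      γ s ∈ E ∧ s ∈ s₁ ∧ s ∈ s₂ :=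
    ((Set.Finite.eventually_all hS).2 hline).and
      ((hγE.and ((eventually_mem_set.2 hs₁).and (eventually_mem_set.2 hs₂))).filter_mono
        nhdsWithin_le_nhds)
  obtain ⟨δ, hδ, hδ'⟩ := (mem_nhdsGT_iff_exists_Ioo_subset).1 hall
  exact ⟨γ, δ, ‖τ‖ / 2, hδ, half_pos hτn, (hlip.mono fun s hs => (hδ' hs).2.2.2).continuousOn,
    fun s hs => ⟨(hδ' hs).2.1, (hδ' hs).1⟩,
    fun s hs s' hs' => hanti s (hδ' hs).2.2.1 s' (hδ' hs').2.2.1⟩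

lemma setLIntegral_edist_zero_rpow_lt_top {r : ℝ} (hr : -1 < r) (δ : ℝ) :
    ∫⁻ u in Ioo (-δ) δ, edist 0 u ^ r < ⊤ := by
  have hint : IntervalIntegrable (fun u : ℝ => |u| ^ r) volume (-δ) δ := by
    refine intervalIntegrable_of_even (fun x => by rw [abs_neg]) (fun t ht => ?_)
    refine (intervalIntegral.intervalIntegrable_rpow' (a := 0) (b := t) hr).congr ?_
    intro x hx
    rw [uIoc_of_le ht.le] at hx
    simp only [abs_of_pos hx.1]
  have hfin : ∫⁻ u in Ioo (-δ) δ, ‖|u| ^ r‖ₑ < ⊤ := by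
    refine lt_of_le_of_lt (lintegral_mono' (Measure.restrict_mono ?_ le_rfl) le_rfl)
      (intervalIntegrable_iff.1 hint).2
    intro x hx
    exact Ioc_subset_uIoc ⟨hx.1, hx.2.le⟩
  refine lt_of_le_of_lt (lintegral_mono_ae ?_) hfin
  have h0 : ∀ᵐ u : ℝ ∂(volume.restrict (Ioo (-δ) δ)), u ≠ 0 :=
    ae_restrict_of_ae (by simp [ae_iff])
  filter_upwards [h0] with u hu
  rw [edist_comm, edist_dist, Real.dist_eq, sub_zero,
    ENNReal.ofReal_rpow_of_pos (abs_pos.2 hu), Real.enorm_of_nonneg (by positivity)]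

/-- An arc carries measures of finite energy when `N - 1 < α`. -/
lemma exists_measure_energy_map_lt_top (hα : N - 1 < α) (hαN : α < N)
    {γ : ℝ → EuclideanSpace ℝ (Fin N)} {δ c : ℝ} (hδ : 0 < δ) (hc : 0 < c)
    (hγ : ContinuousOn γ (Ioo 0 δ))
    (hγc : ∀ s ∈ Ioo 0 δ, ∀ s' ∈ Ioo 0 δ, c * dist s s' ≤ dist (γ s) (γ s')) :
    ∃ ρ : Measure ℝ, IsProbabilityMeasure ρ ∧ (∀ᵐ s ∂ρ, s ∈ Ioo 0 δ) ∧ AEMeasurable γ ρ ∧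
      energy α (ρ.map γ) < ⊤ := by
  set I := Ioo 0 δ
  set ρ₀ : Measure ℝ := volume.restrict I
  have hvol : volume I = ENNReal.ofReal δ := by simp [I]
  have hv0 : volume I ≠ 0 := by simp [hvol, hδ]
  have hvt : volume I ≠ ⊤ := by simp [hvol]
  have hk : (volume I)⁻¹ ≠ ⊤ := ENNReal.inv_ne_top.2 hv0
  -- Differences of two points of `I` lie in `Ioo (-δ) δ`, so `C` bounds all inner integrals at
  -- once; it is finite because `α - N > -1`.
  set C := ∫⁻ u in Ioo (-δ) δ, edist 0 u ^ (α - N)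
  have hC : C < ⊤ := setLIntegral_edist_zero_rpow_lt_top (by linarith) δ
  have hγm : AEMeasurable γ ((volume I)⁻¹ • ρ₀) :=
    (hγ.aemeasurable measurableSet_Ioo).smul_measure _
  have hmem : ∀ᵐ s ∂((volume I)⁻¹ • ρ₀), s ∈ I :=
    Measure.ae_smul_measure (ae_restrict_mem measurableSet_Ioo) _
  have hp : IsProbabilityMeasure ((volume I)⁻¹ • ρ₀) := by
    constructor
    simp [ρ₀, ENNReal.inv_mul_cancel hv0 hvt]
  refine ⟨(volume I)⁻¹ • ρ₀, hp, hmem, hγm, ?_⟩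
  have hc' : ENNReal.ofReal c ^ (α - N) ≠ ⊤ :=
    ENNReal.rpow_ne_top_of_ne_zero (by simpa using hc) ENNReal.ofReal_ne_top
  have hker : ∀ s ∈ I, ∀ s' ∈ I,
      kernel α (γ s) (γ s') ≤ ENNReal.ofReal c ^ (α - N) * edist s s' ^ (α - N) := by
    intro s hs s' hs'
    rw [← ENNReal.mul_rpow_of_ne_top ENNReal.ofReal_ne_top (edist_ne_top _ _)]
    refine kernel_le_of_edist_le hαN ?_
    rw [edist_dist, edist_dist, ← ENNReal.ofReal_mul hc.le]
    exact ENNReal.ofReal_le_ofReal (hγc s hs s' hs')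
  have hinner : ∀ s ∈ I, ∫⁻ s', edist s s' ^ (α - N) ∂ρ₀ ≤ C := by
    intro s hs
    have hsub : ∫⁻ s', (Ioo (-δ) δ).indicator (fun u => edist 0 u ^ (α - N)) (s - s') = C := by
      rw [lintegral_sub_left_eq_self (fun u => (Ioo (-δ) δ).indicator
        (fun u => edist 0 u ^ (α - N)) u), lintegral_indicator measurableSet_Ioo]
    rw [← hsub, ← lintegral_indicator measurableSet_Ioo]
    refine lintegral_mono fun s' => ?_
    by_cases hs' : s' ∈ I
    · have : s - s' ∈ Ioo (-δ) δ := ⟨by linarith [hs.1, hs'.2], by linarith [hs.2, hs'.1]⟩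
      rw [indicator_of_mem hs', indicator_of_mem this, edist_dist, edist_dist, Real.dist_eq,
        Real.dist_eq, zero_sub, abs_neg]
    · rw [indicator_of_notMem hs']
      exact zero_le
  have hpot : ∀ s ∈ I, potential α (((volume I)⁻¹ • ρ₀).map γ) (γ s) ≤
      (volume I)⁻¹ * (ENNReal.ofReal c ^ (α - N) * C) := by
    intro s hs
    rw [potential, lintegral_map' (continuous_kernel_right α _).measurable.aemeasurable hγm,
      lintegral_smul_measure, smul_eq_mul]
    gcongr
    calc ∫⁻ s', kernel α (γ s) (γ s') ∂ρ₀
        ≤ ∫⁻ s', ENNReal.ofReal c ^ (α - N) * edist s s' ^ (α - N) ∂ρ₀ :=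
          setLIntegral_mono' measurableSet_Ioo fun s' hs' => hker s hs s' hs'
      _ = ENNReal.ofReal c ^ (α - N) * ∫⁻ s', edist s s' ^ (α - N) ∂ρ₀ :=
          lintegral_const_mul' _ _ hc'
      _ ≤ _ := by gcongr; exact hinner s hs
  have hpm : IsProbabilityMeasure (((volume I)⁻¹ • ρ₀).map γ) :=
    Measure.isProbabilityMeasure_map hγm
  rw [energy, lintegral_map' (measurable_potential α _).aemeasurable hγm]
  refine lt_of_le_of_lt (lintegral_mono_ae (hmem.mono fun s hs => hpot s hs)) ?_
  rw [lintegral_const, measure_univ, mul_one]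
  exact ENNReal.mul_lt_top hk.lt_top (ENNReal.mul_lt_top hc'.lt_top hC)

/-! ### Strict subharmonicity of the planar kernel, in discrete form. -/

/-- The two terms have product `(1 - c²) ^ (-q) ≥ 1`, so the arithmetic-geometric mean inequality
applies. -/
lemma two_le_rpow_neg_add_rpow_neg {q c : ℝ} (hq : 0 ≤ q) (hc : |c| < 1) :
    2 ≤ (1 + c) ^ (-q) + (1 - c) ^ (-q) := by
  obtain ⟨h1, h2⟩ := abs_lt.1 hc
  have hp : 0 < 1 + c := by linarith
  have hm : 0 < 1 - c := by linarith
  have hprod : 1 ≤ (1 + c) ^ (-q) * (1 - c) ^ (-q) := by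
    rw [← Real.mul_rpow hp.le hm.le]
    exact Real.one_le_rpow_of_pos_of_le_one_of_nonpos (by positivity)
      (by nlinarith [sq_nonneg c]) (by linarith)
  nlinarith [sq_nonneg ((1 + c) ^ (-q) - (1 - c) ^ (-q)), Real.rpow_pos_of_pos hp (-q),
    Real.rpow_pos_of_pos hm (-q)]

/-- The second derivative of the difference is nonnegative by the preceding inequality with exponent
`p + 2`. -/
lemma two_add_sq_le_rpow_neg_add_rpow_neg {p c : ℝ} (hp : 0 ≤ p) (hc : |c| < 1) :
    2 + p * (p + 1) * c ^ 2 ≤ (1 + c) ^ (-p) + (1 - c) ^ (-p) := by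
  let f : ℝ → ℝ := fun c => (1 + c) ^ (-p) + (1 - c) ^ (-p) - p * (p + 1) * c ^ 2
  let f' : ℝ → ℝ := fun c =>
    -p * (1 + c) ^ (-p - 1) + p * (1 - c) ^ (-p - 1) - 2 * p * (p + 1) * c
  let f'' : ℝ → ℝ := fun c =>
    p * (p + 1) * ((1 + c) ^ (-(p + 2)) + (1 - c) ^ (-(p + 2)) - 2)
  have hder : ∀ (q x : ℝ), x ∈ Ioo (-1 : ℝ) 1 →
      HasDerivAt (fun c : ℝ => (1 + c) ^ q) (q * (1 + x) ^ (q - 1)) x ∧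
      HasDerivAt (fun c : ℝ => (1 - c) ^ q) (-(q * (1 - x) ^ (q - 1))) x := by
    intro q x hx
    have h1 : (1 + x) ≠ 0 := by linarith [hx.1]
    have h2 : (1 - x) ≠ 0 := by linarith [hx.2]
    constructor
    · simpa using ((hasDerivAt_id x).const_add 1).rpow_const (p := q) (Or.inl h1)
    · have := ((hasDerivAt_id x).const_sub 1).rpow_const (p := q) (Or.inl h2)
      simpa using this
  have hf : ∀ x ∈ Ioo (-1 : ℝ) 1, HasDerivAt f (f' x) x := by
    intro x hx
    obtain ⟨h1, h2⟩ := hder (-p) x hx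
    have h3 := (hasDerivAt_pow 2 x).const_mul (p * (p + 1))
    refine HasDerivAt.congr_deriv (f := f) ((h1.add h2).sub h3) ?_
    simp only [f']
    norm_num
    ring
  have hf' : ∀ x ∈ Ioo (-1 : ℝ) 1, HasDerivAt f' (f'' x) x := by
    intro x hx
    obtain ⟨h1, h2⟩ := hder (-p - 1) x hx
    have h3 := (hasDerivAt_id x).const_mul (2 * p * (p + 1))
    refine HasDerivAt.congr_deriv (f := f') (((h1.const_mul (-p)).add (h2.const_mul p)).sub h3) ?_
    simp only [f'']
    rw [show -(p + 2) = -p - 1 - 1 by ring]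
    ring
  have hf'' : ∀ x ∈ Ioo (-1 : ℝ) 1, 0 ≤ f'' x := by
    intro x hx
    have := two_le_rpow_neg_add_rpow_neg (q := p + 2) (by linarith) (abs_lt.2 ⟨hx.1, hx.2⟩)
    exact mul_nonneg (by positivity) (by linarith)
  have hconv : ConvexOn ℝ (Ioo (-1 : ℝ) 1) f := by
    refine convexOn_of_hasDerivWithinAt2_nonneg (convex_Ioo _ _)
      (fun x hx => (hf x hx).continuousAt.continuousWithinAt) (f' := f') (f'' := f'') ?_ ?_ ?_
    · rw [interior_Ioo]; exact fun x hx => (hf x hx).hasDerivWithinAt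
    · rw [interior_Ioo]; exact fun x hx => (hf' x hx).hasDerivWithinAt
    · rw [interior_Ioo]; exact hf''
  have hmem : c ∈ Ioo (-1 : ℝ) 1 := abs_lt.1 hc
  have hmem' : -c ∈ Ioo (-1 : ℝ) 1 := ⟨by linarith [hmem.2], by linarith [hmem.1]⟩
  -- `f` is even and convex, hence minimal at `0`
  have h := hconv.2 hmem hmem' (by norm_num : (0 : ℝ) ≤ 1 / 2) (by norm_num : (0 : ℝ) ≤ 1 / 2)
    (by norm_num)
  have h0 : f ((1 / 2 : ℝ) • c + (1 / 2 : ℝ) • (-c)) = 2 := by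
    simp [f]; norm_num
  rw [h0] at h
  simp only [f, smul_eq_mul] at h
  rw [show 1 + -c = 1 - c by ring, show 1 - -c = 1 + c by ring] at h
  nlinarith

/-- The kernel `|w| ^ (-2 p)` in the plane is strictly subharmonic: its value at `w` is less than
its mean over four nearby points. -/
lemma four_mul_rpow_lt {p h w₁ w₂ : ℝ} (hp : 0 < p) (hp1 : p ≤ 1) (hh : 0 < h)
    (hw : 4 * h ^ 2 ≤ p * (w₁ ^ 2 + w₂ ^ 2)) :
    4 * (w₁ ^ 2 + w₂ ^ 2) ^ (-p) <
      ((w₁ + h) ^ 2 + w₂ ^ 2) ^ (-p) + ((w₁ - h) ^ 2 + w₂ ^ 2) ^ (-p) +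
      ((w₁ ^ 2 + (w₂ + h) ^ 2) ^ (-p) + (w₁ ^ 2 + (w₂ - h) ^ 2) ^ (-p)) := by
  set R := w₁ ^ 2 + w₂ ^ 2 with hR
  have hR0 : 0 < R := by
    by_contra! hcon
    nlinarith [pow_pos hh 2]
  -- The four neighbours have squared norms `b ± 2 h w₁` and `b ± 2 h w₂`, so each opposite pair
  -- falls under the even lower bound after factoring out `b`.
  set b := R + h ^ 2 with hb
  have hb0 : 0 < b := by positivity
  have hpair : ∀ w : ℝ, w ^ 2 ≤ R →
      b ^ (-p) * (2 + p * (p + 1) * (2 * h * w / b) ^ 2) ≤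
        (b + 2 * h * w) ^ (-p) + (b - 2 * h * w) ^ (-p) := by
    intro w hwR
    have hlt : |2 * h * w / b| < 1 := by
      rw [abs_div, abs_of_pos hb0, div_lt_one hb0]
      apply abs_lt_of_sq_lt_sq _ hb0.le
      have h4 : 4 * h ^ 2 ≤ R := hw.trans (by nlinarith)
      have : (2 * h * w) ^ 2 = 4 * h ^ 2 * w ^ 2 := by ring
      rw [this, hb]
      nlinarith [pow_pos hh 2, mul_nonneg (pow_pos hh 2).le (sub_nonneg.2 hwR),
        sq_nonneg (R - h ^ 2), mul_pos hR0 (pow_pos hh 2)]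
    have h1 := two_add_sq_le_rpow_neg_add_rpow_neg hp.le hlt
    have h2 := mul_le_mul_of_nonneg_left h1 (Real.rpow_pos_of_pos hb0 (-p)).le
    refine h2.trans_eq ?_
    obtain ⟨h3, h4⟩ := abs_lt.1 hlt
    rw [mul_add, ← Real.mul_rpow hb0.le (by linarith), ← Real.mul_rpow hb0.le (by linarith)]
    congr 2 <;> field_simp
  have e1 : (w₁ + h) ^ 2 + w₂ ^ 2 = b + 2 * h * w₁ := by rw [hb, hR]; ring
  have e2 : (w₁ - h) ^ 2 + w₂ ^ 2 = b - 2 * h * w₁ := by rw [hb, hR]; ring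
  have e3 : w₁ ^ 2 + (w₂ + h) ^ 2 = b + 2 * h * w₂ := by rw [hb, hR]; ring
  have e4 : w₁ ^ 2 + (w₂ - h) ^ 2 = b - 2 * h * w₂ := by rw [hb, hR]; ring
  rw [e1, e2, e3, e4]
  refine lt_of_lt_of_le ?_ (add_le_add (hpair w₁ (by nlinarith)) (hpair w₂ (by nlinarith)))
  rw [← mul_add]
  have hsum : 2 + p * (p + 1) * (2 * h * w₁ / b) ^ 2 + (2 + p * (p + 1) * (2 * h * w₂ / b) ^ 2) =
      4 * (1 + p * (p + 1) * (h ^ 2 * R / b ^ 2)) := by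
    rw [hR]; field_simp; ring
  rw [hsum]
  set η := h ^ 2 / R with hη
  have hη0 : 0 < η := by positivity
  have hηp : η ≤ p / 4 := by
    rw [hη, div_le_iff₀ hR0]; linarith
  have hbη : b = R * (1 + η) := by rw [hb, hη]; field_simp
  have hfrac : h ^ 2 * R / b ^ 2 = η / (1 + η) ^ 2 := by
    rw [hbη, hη]; field_simp
  have hbp : b ^ (-p) = R ^ (-p) * (1 + η) ^ (-p) := by
    rw [hbη, Real.mul_rpow hR0.le (by positivity)]
  have hbern : (1 + η) ^ p ≤ 1 + p * η :=
    rpow_one_add_le_one_add_mul_self (by linarith) hp.le hp1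
  -- The condition `4 h² ≤ p R` was chosen to give `η ≤ p / 4`, hence `(1 + η)² < 1 + p`: the
  -- second-order gain beats the loss `(1 + η) ^ p ≤ 1 + p η` caused by `b > R`.
  have hkey : 1 + p * η < 1 + p * (p + 1) * (η / (1 + η) ^ 2) := by
    have : (1 + η) ^ 2 < p + 1 := by nlinarith
    have h5 : η < (p + 1) * (η / (1 + η) ^ 2) := by
      rw [← mul_div_assoc, lt_div_iff₀ (by positivity)]
      nlinarith
    nlinarith
  have hpow : 0 < (1 + η) ^ p := by positivity
  have hRp : 0 < R ^ (-p) := by positivity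
  rw [hfrac, hbp, Real.rpow_neg (by positivity : (0:ℝ) ≤ 1 + η)]
  have h6 : 1 < ((1 + η) ^ p)⁻¹ * (1 + p * (p + 1) * (η / (1 + η) ^ 2)) := by
    rw [← div_eq_inv_mul, lt_div_iff₀ hpow]; linarith
  nlinarith

lemma kernel_plane_eq {x y : EuclideanSpace ℝ (Fin 2)} (hxy : x ≠ y) :
    kernel α x y =
      ENNReal.ofReal (((x 0 - y 0) ^ 2 + (x 1 - y 1) ^ 2) ^ (-((2 - α) / 2))) := by
  have h : dist x y = ((x 0 - y 0) ^ 2 + (x 1 - y 1) ^ 2) ^ (1 / 2 : ℝ) := by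
    rw [EuclideanSpace.dist_eq, Real.sqrt_eq_rpow, Fin.sum_univ_two, Real.dist_eq, Real.dist_eq,
      sq_abs, sq_abs]
  rw [kernel_eq_ofReal hxy, h, ← Real.rpow_mul (by positivity)]
  congr 2
  push_cast
  ring

lemma four_mul_kernel_lt (hα : 0 ≤ α) (hα2 : α < 2) {x t : EuclideanSpace ℝ (Fin 2)} {h : ℝ}
    (hh : 0 < h) (hxt : 4 * h ^ 2 ≤ (2 - α) / 2 * dist x t ^ 2) :
    4 * kernel α x t <
      kernel α (x + EuclideanSpace.single 0 h) t + kernel α (x - EuclideanSpace.single 0 h) t +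
      (kernel α (x + EuclideanSpace.single 1 h) t +
        kernel α (x - EuclideanSpace.single 1 h) t) := by
  have hd : h < dist x t := by
    by_contra! hcon
    have := pow_le_pow_left₀ dist_nonneg hcon 2
    nlinarith [pow_pos hh 2, sq_nonneg (dist x t)]
  have hx : x ≠ t := dist_pos.1 (hh.trans hd)
  have hne : ∀ i, x + EuclideanSpace.single i h ≠ t ∧ x - EuclideanSpace.single i h ≠ t := by
    intro i
    constructor
    · rintro rfl
      simp [abs_of_pos hh] at hd
    · rintro rfl
      simp [abs_of_pos hh] at hd
  have hsq : dist x t ^ 2 = (x 0 - t 0) ^ 2 + (x 1 - t 1) ^ 2 := by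
    rw [EuclideanSpace.dist_eq, Real.sq_sqrt (by positivity), Fin.sum_univ_two, Real.dist_eq,
      Real.dist_eq, sq_abs, sq_abs]
  have key := four_mul_rpow_lt (p := (2 - α) / 2) (by linarith) (by linarith) hh (hsq ▸ hxt)
  rw [kernel_plane_eq hx, kernel_plane_eq (hne 0).1, kernel_plane_eq (hne 0).2,
    kernel_plane_eq (hne 1).1, kernel_plane_eq (hne 1).2,
    ← ENNReal.ofReal_add (by positivity) (by positivity),
    ← ENNReal.ofReal_add (by positivity) (by positivity),
    ← ENNReal.ofReal_add (by positivity) (by positivity),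
    show (4 : ℝ≥0∞) = ENNReal.ofReal 4 by simp, ← ENNReal.ofReal_mul (by norm_num)]
  refine (ENNReal.ofReal_lt_ofReal_iff_of_nonneg (by positivity)).2 (key.trans_eq ?_)
  simp only [PiLp.add_apply, PiLp.sub_apply, PiLp.single_apply, Fin.isValue,
    ↓reduceIte, zero_ne_one, one_ne_zero, add_zero, sub_zero]
  ring_nf

lemma potential_le_of_forall_edist_le (hα : α < N) {m : Measure (EuclideanSpace ℝ (Fin N))}
    {x : EuclideanSpace ℝ (Fin N)} {r : ℝ≥0∞} (h : ∀ᵐ t ∂m, r ≤ edist x t) :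
    potential α m x ≤ r ^ (α - (N : ℝ)) * m univ := by
  rw [potential, ← lintegral_const]
  exact lintegral_mono_ae (h.mono fun t ht => kernel_le_of_edist_le hα ht)

/-- Strict subharmonicity of planar Riesz potentials away from the measure. -/
lemma four_mul_potential_lt (hα : 0 ≤ α) (hα2 : α < 2) {m : Measure (EuclideanSpace ℝ (Fin 2))}
    [SFinite m] (hm : m ≠ 0) {x : EuclideanSpace ℝ (Fin 2)} {h : ℝ} (hh : 0 < h)
    (hx : ∀ᵐ t ∂m, 4 * h ^ 2 ≤ (2 - α) / 2 * dist x t ^ 2) (hfin : potential α m x < ⊤) :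
    4 * potential α m x <
      potential α m (x + EuclideanSpace.single 0 h) +
        potential α m (x - EuclideanSpace.single 0 h) +
      (potential α m (x + EuclideanSpace.single 1 h) +
        potential α m (x - EuclideanSpace.single 1 h)) := by
  have hmeas : ∀ y : EuclideanSpace ℝ (Fin 2), Measurable fun t => kernel α y t := fun y =>
    (continuous_kernel_right α y).measurable
  have hmeas₂ : ∀ y z : EuclideanSpace ℝ (Fin 2),
      Measurable fun t => kernel α y t + kernel α z t := fun y z => (hmeas y).add (hmeas z)
  simp only [potential] at hfin ⊢
  rw [← lintegral_add_left (hmeas _), ← lintegral_add_left (hmeas _),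
    ← lintegral_add_left (hmeas₂ _ _), ← lintegral_const_mul _ (hmeas _)]
  refine lintegral_strict_mono hm ?_ ?_ (hx.mono fun t ht => four_mul_kernel_lt hα hα2 hh ht)
  · exact (((hmeas _).add (hmeas _)).add ((hmeas _).add (hmeas _))).aemeasurable
  · rw [lintegral_const_mul _ (hmeas _)]
    exact (ENNReal.mul_lt_top (by simp) hfin).ne

lemma exists_four_mul_potential_lt (hα : 0 ≤ α) (hα2 : α < 2)
    {m : Measure (EuclideanSpace ℝ (Fin 2))} [IsFiniteMeasure m] (hm : m ≠ 0)
    {A : Set (EuclideanSpace ℝ (Fin 2))} (hA : IsClosed A) (hmA : m Aᶜ = 0)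
    {x : EuclideanSpace ℝ (Fin 2)} (hx : x ∉ A) :
    ∃ y₁ ∉ A, ∃ y₂ ∉ A, ∃ y₃ ∉ A, ∃ y₄ ∉ A, 4 * potential α m x <
      potential α m y₁ + potential α m y₂ + (potential α m y₃ + potential α m y₄) := by
  obtain ⟨r, hr, hball⟩ := Metric.isOpen_iff.1 hA.isOpen_compl x hx
  have hdist : ∀ t ∈ A, r ≤ dist x t := fun t ht => by
    by_contra! hcon
    exact hball (by rwa [Metric.mem_ball, dist_comm]) ht
  have hae : ∀ᵐ t ∂m, t ∈ A := by rw [ae_iff]; exact hmA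
  -- This makes `4 h² = (2 - α) / 2 * r²`, the bound required by the kernel inequality, and keeps `h
  -- < r`, so the four neighbours stay off `A`.
  set h := Real.sqrt ((2 - α) / 8) * r with hhdef
  have hc : 0 < (2 - α) / 8 := by linarith
  have hh : 0 < h := by positivity
  have hh2 : h ^ 2 = (2 - α) / 8 * r ^ 2 := by rw [hhdef, mul_pow, Real.sq_sqrt hc.le]
  have hhr : h < r := by
    refine lt_of_pow_lt_pow_left₀ 2 hr.le ?_
    rw [hh2]; nlinarith [pow_pos hr 2]
  have hfin : potential α m x < ⊤ := by
    refine (potential_le_of_forall_edist_le (r := ENNReal.ofReal r) (by exact_mod_cast hα2)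
      (hae.mono fun t ht => ?_)).trans_lt (ENNReal.mul_lt_top ?_ (measure_lt_top m _))
    · rw [edist_dist]; exact ENNReal.ofReal_le_ofReal (hdist t ht)
    · exact (ENNReal.rpow_ne_top_of_ne_zero (by simpa using hr) ENNReal.ofReal_ne_top).lt_top
  have hout : ∀ i, x + EuclideanSpace.single i h ∉ A ∧ x - EuclideanSpace.single i h ∉ A := by
    intro i
    constructor <;> refine fun hmem => (hball ?_) hmem <;>
      simpa [Metric.mem_ball, dist_eq_norm, abs_of_pos hh] using hhr
  refine ⟨_, (hout 0).1, _, (hout 0).2, _, (hout 1).1, _, (hout 1).2,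
    four_mul_potential_lt hα hα2 hm hh (hae.mono fun t ht => ?_) hfin⟩
  rw [hh2]
  have := pow_le_pow_left₀ hr.le (hdist t ht) 2
  nlinarith

/-! ### The planar maximum principle. -/

/-- The part of the potential coming from kernel values above level `n`. -/
def potentialTail (α : ℝ) (m : Measure (EuclideanSpace ℝ (Fin N))) (n : ℝ≥0∞)
    (x : EuclideanSpace ℝ (Fin N)) : ℝ≥0∞ :=
  ∫⁻ t, (kernel α x t - n) ∂m

lemma measurable_potentialTail (m : Measure (EuclideanSpace ℝ (Fin N))) [SFinite m] (n : ℝ≥0∞) :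
    Measurable (potentialTail α m n) :=
  ((continuous_kernel_uncurry α).measurable.sub_const n).lintegral_prod_right'

lemma potential_eq_add_potentialTail (m : Measure (EuclideanSpace ℝ (Fin N))) (n : ℝ≥0∞)
    (x : EuclideanSpace ℝ (Fin N)) :
    potential α m x = ∫⁻ t, min (kernel α x t) n ∂m + potentialTail α m n x := by
  rw [potential, potentialTail, ← lintegral_add_left
    ((continuous_kernel_right α x).measurable.min measurable_const)]
  refine lintegral_congr fun t => ?_
  rcases le_total (kernel α x t) n with h | h
  · rw [min_eq_left h, tsub_eq_zero_of_le h, add_zero]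
  · rw [min_eq_right h, add_tsub_cancel_of_le h]

lemma continuous_lintegral_min_kernel (m : Measure (EuclideanSpace ℝ (Fin N))) [IsFiniteMeasure m]
    (n : ℕ) : Continuous fun x => ∫⁻ t, min (kernel α x t) n ∂m := by
  rw [continuous_iff_continuousAt]
  intro x
  refine tendsto_lintegral_filter_of_dominated_convergence (fun _ => n)
    (Eventually.of_forall fun y =>
      (continuous_kernel_right α y).measurable.min measurable_const)
    (Eventually.of_forall fun y => ae_of_all _ fun t => min_le_right _ _) ?_
    (ae_of_all _ fun t => ((continuous_kernel_left α t).min continuous_const).tendsto x)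
  rw [lintegral_const]
  exact (ENNReal.mul_lt_top (by simp) (measure_lt_top m _)).ne

/-- For `x'` nearest to `x` in `A`, `|x' - t| ≤ 2 |x - t|` on `A`, so the kernel at `x` is at most
`2 ^ (N - α) ≤ 2` times the kernel at `x'`. Doubling the level absorbs this factor, and tail bounds
on `A` spread to the whole space. -/
lemma potentialTail_two_mul_le (hα : N - 1 ≤ α) (hαN : α ≤ N)
    {m : Measure (EuclideanSpace ℝ (Fin N))} {A : Set (EuclideanSpace ℝ (Fin N))}
    (hA : IsCompact A) (hne : A.Nonempty) (hmA : m Aᶜ = 0) (n : ℕ)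
    (x : EuclideanSpace ℝ (Fin N)) :
    ∃ x' ∈ A, potentialTail α m (2 * n) x ≤ 2 * potentialTail α m n x' := by
  obtain ⟨x', hx', hmin⟩ := hA.exists_infDist_eq_dist hne x
  have hae : ∀ᵐ t ∂m, t ∈ A := by rw [ae_iff]; exact hmA
  refine ⟨x', hx', ?_⟩
  rw [potentialTail, potentialTail, ← lintegral_const_mul' _ _ (by simp)]
  refine lintegral_mono_ae (hae.mono fun t ht => ?_)
  rw [ENNReal.mul_sub (by simp)]
  refine tsub_le_tsub_right ?_ _
  have hdist : edist x' t ≤ 2 * edist x t := by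
    have h1 : dist x x' ≤ dist x t := hmin ▸ Metric.infDist_le_dist_of_mem ht
    have h2 : edist x x' ≤ edist x t := by
      rw [edist_dist, edist_dist]; exact ENNReal.ofReal_le_ofReal h1
    rw [two_mul]
    exact (edist_triangle_left x' t x).trans (by gcongr)
  have h2 : (2 : ℝ≥0∞) ^ ((N : ℝ) - α) ≤ 2 := by
    conv_rhs => rw [← ENNReal.rpow_one 2]
    exact ENNReal.rpow_le_rpow_of_exponent_le (by norm_num) (by linarith)
  have h3 : edist x' t ^ ((N : ℝ) - α) ≤ 2 * edist x t ^ ((N : ℝ) - α) :=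
    calc edist x' t ^ ((N : ℝ) - α) ≤ (2 * edist x t) ^ ((N : ℝ) - α) :=
          ENNReal.rpow_le_rpow hdist (by linarith)
      _ = 2 ^ ((N : ℝ) - α) * edist x t ^ ((N : ℝ) - α) :=
          ENNReal.mul_rpow_of_nonneg _ _ (by linarith)
      _ ≤ _ := by gcongr
  rw [kernel, kernel, ← neg_sub, ENNReal.rpow_neg, ENNReal.rpow_neg]
  rw [← ENNReal.inv_le_inv, inv_inv, ENNReal.mul_inv (by simp) (by simp), inv_inv]
  rw [← ENNReal.div_eq_inv_mul]
  exact ENNReal.div_le_of_le_mul' h3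

/-- Uniform smallness of the tails on a compact carrier gives upper semicontinuity of the
potential on the whole space. -/
lemma upperSemicontinuous_potential (hα : N - 1 ≤ α) (hαN : α ≤ N)
    {m : Measure (EuclideanSpace ℝ (Fin N))} [IsFiniteMeasure m]
    {A : Set (EuclideanSpace ℝ (Fin N))}
    (hA : IsCompact A) (hne : A.Nonempty) (hmA : m Aᶜ = 0)
    (htail : ∀ ε : ℝ≥0, 0 < ε → ∃ n : ℕ, ∀ x ∈ A, potentialTail α m n x ≤ ε) :
    UpperSemicontinuous (potential α m) := by
  have htail' : ∀ ε : ℝ≥0, 0 < ε → ∃ n : ℕ, ∀ x, potentialTail α m n x ≤ ε := by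
    intro ε hε
    obtain ⟨n, hn⟩ := htail (ε / 2) (by positivity)
    refine ⟨2 * n, fun x => ?_⟩
    obtain ⟨x', hx', h⟩ := potentialTail_two_mul_le hα hαN hA hne hmA n x
    push_cast
    refine h.trans ((mul_le_mul' le_rfl (hn x' hx')).trans_eq ?_)
    rw [ENNReal.coe_div two_ne_zero]
    exact ENNReal.mul_div_cancel (by simp) (by simp)
  -- Truncated potentials are continuous, and adding a uniform bound for the tail makes them
  -- majorants; their infimum is the potential.
  have heq : potential α m = fun x =>
      ⨅ q : {q : ℕ × ℝ≥0 // ∀ x, potentialTail α m q.1 x ≤ q.2},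
        (∫⁻ t, min (kernel α x t) (q.1.1 : ℝ≥0∞) ∂m + q.1.2) := by
    funext x
    refine le_antisymm (le_iInf fun q => ?_) (ENNReal.le_of_forall_pos_le_add fun ε hε _ => ?_)
    · rw [potential_eq_add_potentialTail m q.1.1 x]
      gcongr
      exact q.2 x
    · obtain ⟨n, hn⟩ := htail' ε hε
      refine (iInf_le _ ⟨(n, ε), hn⟩).trans ?_
      rw [potential_eq_add_potentialTail m n x]
      gcongr
      exact le_self_add
  rw [heq]
  exact upperSemicontinuous_iInf fun q =>
    ((continuous_lintegral_min_kernel m q.1.1).add continuous_const).upperSemicontinuous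

/-- Maximum principle for planar potentials that are upper semicontinuous. -/
lemma potential_le_of_upperSemicontinuous (hα : 0 ≤ α) (hα2 : α < 2)
    {m : Measure (EuclideanSpace ℝ (Fin 2))} [IsFiniteMeasure m]
    {A : Set (EuclideanSpace ℝ (Fin 2))} (hA : IsCompact A) (hmA : m Aᶜ = 0)
    (husc : UpperSemicontinuous (potential α m)) {W : ℝ≥0∞}
    (hW : ∀ x ∈ A, potential α m x ≤ W) (x : EuclideanSpace ℝ (Fin 2)) :
    potential α m x ≤ W := by
  by_contra! hx
  have hm : m ≠ 0 := by
    rintro rfl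
    simp [potential] at hx
  have hae : ∀ᵐ t ∂m, t ∈ A := by rw [ae_iff]; exact hmA
  -- The potential vanishes at infinity, so a maximum over a large compact set is global. Attained
  -- off `A`, it contradicts the strict four-point mean inequality.
  have hlim : ∀ᶠ y in cocompact (EuclideanSpace ℝ (Fin 2)), potential α m y < potential α m x := by
    obtain ⟨ρ, hρ⟩ := hA.isBounded.subset_closedBall 0
    have hle : ∀ y, potential α m y ≤
        ENNReal.ofReal (‖y‖ - ρ) ^ (α - ((2 : ℕ) : ℝ)) * m univ := fun y => by
      refine potential_le_of_forall_edist_le (by exact_mod_cast hα2) (hae.mono fun t ht => ?_)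
      rw [edist_dist, dist_eq_norm]
      refine ENNReal.ofReal_le_ofReal ?_
      have h1 : ‖t‖ ≤ ρ := by simpa using hρ ht
      linarith [norm_sub_norm_le y t]
    have hnorm : Tendsto (fun y : EuclideanSpace ℝ (Fin 2) => ENNReal.ofReal (‖y‖ - ρ))
        (cocompact _) (𝓝 ⊤) :=
      ENNReal.tendsto_ofReal_nhds_top.2
        (tendsto_atTop_add_const_right _ (-ρ) tendsto_norm_cocompact_atTop)
    have htop : Tendsto (fun z : ℝ≥0∞ => z ^ (α - ((2 : ℕ) : ℝ)) * m univ) (𝓝 ⊤) (𝓝 0) := by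
      have h1 : Tendsto (fun z : ℝ≥0∞ => z ^ (α - ((2 : ℕ) : ℝ))) (𝓝 ⊤) (𝓝 0) :=
        ENNReal.continuous_rpow_const.tendsto' _ _
          (ENNReal.top_rpow_of_neg (by push_cast; linarith))
      simpa using ENNReal.Tendsto.mul_const h1 (Or.inr (measure_ne_top m univ))
    filter_upwards [(htop.comp hnorm).eventually (gt_mem_nhds (pos_of_gt hx))] with y hy
    exact (hle y).trans_lt hy
  obtain ⟨K, hK, hKx⟩ := mem_cocompact.1 hlim
  obtain ⟨z, -, hz⟩ := (husc.upperSemicontinuousOn (insert x K)).exists_isMaxOn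
    (insert_nonempty x K) (hK.insert x)
  have hzx : potential α m x ≤ potential α m z := hz (mem_insert x K)
  have hmax : ∀ y, potential α m y ≤ potential α m z := by
    intro y
    by_cases hy : y ∈ K
    · exact hz (mem_insert_of_mem x hy)
    · exact (hKx hy).le.trans hzx
  have hzA : z ∉ A := fun h => (hx.trans_le hzx).not_ge (hW z h)
  obtain ⟨y₁, -, y₂, -, y₃, -, y₄, -, h⟩ :=
    exists_four_mul_potential_lt hα hα2 hm hA.isClosed hmA hzA
  refine h.not_ge ((add_le_add (add_le_add (hmax y₁) (hmax y₂))
    (add_le_add (hmax y₃) (hmax y₄))).trans_eq ?_)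
  ring

lemma tendsto_potentialTail {m : Measure (EuclideanSpace ℝ (Fin N))}
    {x : EuclideanSpace ℝ (Fin N)} (hx : potential α m x < ⊤) :
    Tendsto (fun n : ℕ => potentialTail α m n x) atTop (𝓝 0) := by
  have hmeas := (continuous_kernel_right α x).measurable
  have := tendsto_lintegral_of_dominated_convergence (μ := m)
    (F := fun (n : ℕ) t => kernel α x t - n) (f := fun _ => 0) (fun t => kernel α x t)
    (fun n => hmeas.sub_const _) (fun n => ae_of_all _ fun t => tsub_le_self) hx.ne ?_
  · simpa using! this
  · filter_upwards [ae_lt_top hmeas hx.ne] with t ht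
    obtain ⟨k, hk⟩ := ENNReal.exists_nat_gt ht.ne
    refine tendsto_const_nhds.congr' ?_
    filter_upwards [eventually_ge_atTop k] with n hn
    exact (tsub_eq_zero_of_le (hk.le.trans (by exact_mod_cast hn))).symm

/-- A measure of finite energy has, up to small mass, uniformly small potential tails on a compact
set. -/
lemma exists_isCompact_potentialTail_le {m : Measure (EuclideanSpace ℝ (Fin N))}
    [IsFiniteMeasure m] (hfin : ∀ᵐ x ∂m, potential α m x < ⊤)
    {G : Set (EuclideanSpace ℝ (Fin N))} (hG : MeasurableSet G) (hmG : m Gᶜ = 0)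
    {η : ℝ} (hη : 0 < η) :
    ∃ A ⊆ G, IsCompact A ∧ m Aᶜ ≤ ENNReal.ofReal η ∧
      ∀ ε : ℝ≥0, 0 < ε → ∃ n : ℕ, ∀ x ∈ A, potentialTail α m n x ≤ ε := by
  -- Egorov's theorem makes the tails uniformly small off a set of small measure; inner regularity
  -- then supplies the compact set.
  obtain ⟨T, hT, hmT, hunif⟩ := tendstoUniformlyOn_of_ae_tendsto' (μ := m)
    (f := fun (n : ℕ) x => (potentialTail α m n x).toReal) (g := fun _ => 0)
    (fun n => (measurable_potentialTail m n).ennreal_toReal.stronglyMeasurable)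
    stronglyMeasurable_const
    (hfin.mono fun x hx => by
      simpa using! (ENNReal.tendsto_toReal ENNReal.zero_ne_top).comp (tendsto_potentialTail hx))
    (half_pos hη)
  set H := {x | potential α m x < ⊤}
  have hH : MeasurableSet H := measurable_potential α m measurableSet_Iio
  set B := (G ∩ H) \ T
  have hB : MeasurableSet B := (hG.inter hH).diff hT
  have hmB : m Bᶜ ≤ ENNReal.ofReal (η / 2) := by
    have hsub : Bᶜ ⊆ Gᶜ ∪ Hᶜ ∪ T := by
      intro x hx
      by_contra hcon
      simp only [mem_union, mem_compl_iff, not_or, not_not] at hcon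
      exact hx ⟨hcon.1, hcon.2⟩
    have hmH : m Hᶜ = 0 := hfin
    calc m Bᶜ ≤ m (Gᶜ ∪ Hᶜ ∪ T) := measure_mono hsub
      _ ≤ m Gᶜ + m Hᶜ + m T := (measure_union_le _ _).trans (by gcongr; exact measure_union_le _ _)
      _ ≤ _ := by rw [hmG, hmH, zero_add, zero_add]; exact hmT
  obtain ⟨A, hAB, hA, hBA⟩ := hB.exists_isCompact_sdiff_lt (measure_ne_top m B)
    (ε := ENNReal.ofReal (η / 2)) (by simpa using hη)
  refine ⟨A, fun x hx => (hAB hx).1.1, hA, ?_, fun ε hε => ?_⟩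
  · have hsub : Aᶜ ⊆ Bᶜ ∪ B \ A := by
      intro x hx
      by_cases h : x ∈ B
      · exact Or.inr ⟨h, hx⟩
      · exact Or.inl h
    calc m Aᶜ ≤ m Bᶜ + m (B \ A) := (measure_mono hsub).trans (measure_union_le _ _)
      _ ≤ ENNReal.ofReal (η / 2) + ENNReal.ofReal (η / 2) := add_le_add hmB hBA.le
      _ = ENNReal.ofReal η := by rw [← ENNReal.ofReal_add (by linarith) (by linarith), add_halves]
  · obtain ⟨n, hn⟩ := (Metric.tendstoUniformlyOn_iff.1 hunif ε (by exact_mod_cast hε)).exists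
    refine ⟨n, fun x hx => ?_⟩
    have h1 := hn x (hAB hx).2
    rw [dist_zero_left, Real.norm_of_nonneg ENNReal.toReal_nonneg] at h1
    have h2 : potentialTail α m n x ≠ ⊤ :=
      (lt_of_le_of_lt (by rw [potential_eq_add_potentialTail m n x]; exact le_add_self)
        (hAB hx).1.2).ne
    rw [← ENNReal.ofReal_toReal h2, ← ENNReal.ofReal_coe_nnreal]
    exact ENNReal.ofReal_le_ofReal h1.le

/-- Planar maximum principle: a potential bounded by `W` almost everywhere is at most `W` off any
closed carrier. -/
theorem potential_le_of_ae_le (hα : 1 ≤ α) (hα2 : α < 2)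
    {m : Measure (EuclideanSpace ℝ (Fin 2))} [IsFiniteMeasure m]
    {F : Set (EuclideanSpace ℝ (Fin 2))} (hF : IsClosed F) (hmF : m Fᶜ = 0) {W : ℝ≥0∞}
    (hWt : W < ⊤) (hW : ∀ᵐ x ∂m, potential α m x ≤ W) {z : EuclideanSpace ℝ (Fin 2)}
    (hz : z ∉ F) : potential α m z ≤ W := by
  obtain ⟨r, hr, hball⟩ := Metric.isOpen_iff.1 hF.isOpen_compl z hz
  have hae : ∀ᵐ t ∂m, t ∈ F := by rw [ae_iff]; exact hmF
  have hdist : ∀ᵐ t ∂m, ENNReal.ofReal r ≤ edist z t := hae.mono fun t ht => by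
    rw [edist_dist]
    refine ENNReal.ofReal_le_ofReal ?_
    by_contra! hcon
    exact hball (by rwa [Metric.mem_ball, dist_comm]) ht
  set M := ENNReal.ofReal r ^ (α - ((2 : ℕ) : ℝ))
  have hM : M ≠ ⊤ := ENNReal.rpow_ne_top_of_ne_zero (by simpa using hr) ENNReal.ofReal_ne_top
  have hle : ∀ η : ℝ, 0 < η → potential α m z ≤ W + M * ENNReal.ofReal η := by
    intro η hη
    -- The potential of `m` need not be upper semicontinuous, but that of its restriction to `A` is,
    -- so the maximum principle applies to it. The rest has mass at most `η` at distance at least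
    -- `r` from `z`, and contributes at most `M η`.
    obtain ⟨A, hAG, hA, hmA, htail⟩ := exists_isCompact_potentialTail_le
      (hW.mono fun x hx => hx.trans_lt hWt) (G := {x | potential α m x ≤ W})
      (measurable_potential α m measurableSet_Iic) hW hη
    have hAm := hA.measurableSet
    have hsplit : potential α m z =
        potential α (m.restrict A) z + potential α (m.restrict Aᶜ) z := by
      simp only [potential]
      exact (lintegral_add_compl _ hAm).symm
    rw [hsplit]
    refine add_le_add ?_ ?_
    · rcases A.eq_empty_or_nonempty with rfl | hne
      · simp [potential]
      · have hcar : m.restrict A Aᶜ = 0 := by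
          rw [Measure.restrict_apply hAm.compl]; simp
        refine potential_le_of_upperSemicontinuous (by linarith) hα2 hA hcar
          (upperSemicontinuous_potential (by push_cast; linarith) (by push_cast; linarith) hA hne
            hcar fun ε hε => ?_)
          (fun x hx => (potential_mono Measure.restrict_le_self x).trans (hAG hx)) z
        obtain ⟨n, hn⟩ := htail ε hε
        exact ⟨n, fun x hx =>
          (lintegral_mono' Measure.restrict_le_self le_rfl).trans (hn x hx)⟩
    · refine (potential_le_of_forall_edist_le (by exact_mod_cast hα2)
        (ae_restrict_of_ae hdist)).trans ?_
      rw [Measure.restrict_apply_univ]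
      exact mul_le_mul' le_rfl hmA
  have hlim : Tendsto (fun η : ℝ => W + M * ENNReal.ofReal η) (𝓝[>] 0) (𝓝 W) := by
    have h1 : Tendsto (fun η : ℝ => ENNReal.ofReal η) (𝓝[>] 0) (𝓝 0) :=
      (ENNReal.continuous_ofReal.tendsto' 0 0 (by simp)).mono_left nhdsWithin_le_nhds
    simpa using (ENNReal.Tendsto.const_mul h1 (Or.inr hM)).const_add W
  exact ge_of_tendsto hlim (by filter_upwards [self_mem_nhdsWithin] with η hη using hle η hη)

/-- The weak bound at four neighbours off `F`, combined with the strict mean inequality, gives the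
strict bound at `z`. -/
theorem potential_lt_of_ae_le (hα : 1 ≤ α) (hα2 : α < 2)
    {m : Measure (EuclideanSpace ℝ (Fin 2))} [IsFiniteMeasure m] (hm : m ≠ 0)
    {F : Set (EuclideanSpace ℝ (Fin 2))} (hF : IsClosed F) (hmF : m Fᶜ = 0) {W : ℝ≥0∞}
    (hWt : W < ⊤) (hW : ∀ᵐ x ∂m, potential α m x ≤ W) {z : EuclideanSpace ℝ (Fin 2)}
    (hz : z ∉ F) : potential α m z < W := by
  obtain ⟨y₁, h₁, y₂, h₂, y₃, h₃, y₄, h₄, h⟩ :=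
    exists_four_mul_potential_lt (by linarith) hα2 hm hF hmF hz
  have hle : ∀ y ∉ F, potential α m y ≤ W := fun y hy =>
    potential_le_of_ae_le hα hα2 hF hmF hWt hW hy
  have h4 : 4 * potential α m z < 4 * W := by
    refine h.trans_le ((add_le_add (add_le_add (hle _ h₁) (hle _ h₂))
      (add_le_add (hle _ h₃) (hle _ h₄))).trans_eq ?_)
    ring
  exact lt_of_mul_lt_mul_left' h4

/-! ### Infinitude of dominant sets and the conclusion. -/

/-- In the plane, for `1 < α < 2`, the equilibrium measure is not carried by finitely many
lines. -/
lemma IsEquilibriumMeasure.not_support_subset_lines {α : ℝ} (hα : 1 < α) (hα2 : α < 2)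
    {E S : Set (EuclideanSpace ℝ (Fin 2))} {μ : Measure (EuclideanSpace ℝ (Fin 2))}
    (hE : IsCompact E) (hW : minEnergy α E < ⊤) (hbd : HasC1Boundary E)
    (hμ : IsEquilibriumMeasure α E μ) (hS : S.Finite)
    (v : EuclideanSpace ℝ (Fin 2) → EuclideanSpace ℝ (Fin 2)) :
    ¬ μ.support ⊆ ⋃ t ∈ S, {x | x - t ∈ Submodule.span ℝ {v t}} := by
  intro hsub
  have := hμ.isProbabilityMeasure
  have hne : E.Nonempty := by
    rw [nonempty_iff_ne_empty]
    rintro rfl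
    simpa using hμ.carried
  obtain ⟨γ, δ, c, hδ, hc, hγ, hγS, hγc⟩ := exists_arc_avoiding_lines le_rfl hE hne hbd hS v
  obtain ⟨ρ, hρ, hρI, hγm, hρe⟩ := exists_measure_energy_map_lt_top (α := α)
    (by push_cast; linarith) (by exact_mod_cast hα2) hδ hc hγ hγc
  have hE0 : ρ.map γ Eᶜ = 0 := by
    rw [Measure.map_apply_of_aemeasurable hγm hE.measurableSet.compl]
    exact measure_mono_null (fun s hs hsI => hs (hγS s hsI).1) (ae_iff.1 hρI)
  have hle := hμ.minEnergy_le_lintegral_potential hW (Measure.isProbabilityMeasure_map hγm) hE0 hρe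
  rw [lintegral_map' (measurable_potential α μ).aemeasurable hγm] at hle
  -- The arc avoids the lines, hence the support, so the strict maximum principle holds along it.
  have hlt : ∀ᵐ s ∂ρ, potential α μ (γ s) < minEnergy α E := by
    filter_upwards [hρI] with s hs
    refine potential_lt_of_ae_le hα.le hα2 (IsProbabilityMeasure.ne_zero μ)
      Measure.isClosed_support Measure.measure_compl_support hW
      ((hμ.ae_potential_eq hW).mono fun x hx => hx.le) fun hmem => ?_
    obtain ⟨t, htS, ht⟩ := mem_iUnion₂.1 (hsub hmem)
    exact (hγS s hs).2 t htS ht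
  have hstrict : ∫⁻ s, potential α μ (γ s) ∂ρ < ∫⁻ _, minEnergy α E ∂ρ := by
    refine lintegral_strict_mono (IsProbabilityMeasure.ne_zero ρ) aemeasurable_const ?_ hlt
    refine (lt_of_le_of_lt (lintegral_mono_ae (hlt.mono fun s hs => hs.le)) ?_).ne
    simpa using hW
  rw [lintegral_const, measure_univ, mul_one] at hstrict
  exact hle.not_gt hstrict

theorem IsDominant.infinite (hN : 2 ≤ N) (hα2 : α ≤ 2) (hαN : α ≠ N)
    {E S : Set (EuclideanSpace ℝ (Fin N))} {μ : Measure (EuclideanSpace ℝ (Fin N))}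
    (hE : IsCompact E) (hW : minEnergy α E < ⊤) (hbd : HasC1Boundary E)
    (hμ : IsEquilibriumMeasure α E μ) (hS : IsDominant E μ S) : S.Infinite := by
  intro hfin
  have : NeZero N := ⟨by omega⟩
  have := hμ.isProbabilityMeasure
  obtain ⟨v, hv⟩ := hS.exists_lines hE hbd
  -- Below the threshold `N - 1` lines are null for measures of finite energy; above it only the
  -- planar case survives.
  rcases le_or_gt α (N - 1) with hα | hα
  · have hnull : μ μ.support = 0 :=
      measure_mono_null hv ((measure_biUnion_null_iff hfin.countable).2 fun t _ =>
        measure_line_eq_zero hα (hμ.energy_eq.trans_lt hW) t (v t))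
    have huniv : μ univ = 0 := by
      rw [← union_compl_self μ.support]
      exact measure_union_null hnull Measure.measure_compl_support
    simp at huniv
  · have hN2 : N = 2 := by
      have h3 : (N : ℝ) < 3 := by linarith
      have h3' : N < 3 := by exact_mod_cast h3
      omega
    subst hN2
    push_cast at hα hαN
    exact hμ.not_support_subset_lines (by linarith) (lt_of_le_of_ne hα2 hαN) hE hW hbd hfin v hv

end RieszPotential

end

theorem corollary2p5 (N : ℕ) (hN : 2 ≤ N) (α : ℝ) (hα0 : 0 < α) (hα2 : α ≤ 2) (hαN : α ≠ N)
    (E : Set (EuclideanSpace ℝ (Fin N))) (hE : IsCompact E)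
    (hW : RieszPotential.minEnergy α E < ⊤)
    (hbd : RieszPotential.HasC1Boundary E) (hcomp : Finite (ConnectedComponents E)) :
    (∃ μ, RieszPotential.IsEquilibriumMeasure α E μ) ∧
    ∀ μ, RieszPotential.IsEquilibriumMeasure α E μ →
      (∀ m : ℕ, 2 ≤ m → RieszPotential.const α E μ < RieszPotential.constFin α E μ m) ∧
      (∀ S, RieszPotential.IsDominant E μ S → S.Infinite) := by
  have hN' : (2 : ℝ) ≤ N := by exact_mod_cast hN
  have hα : α < N := lt_of_le_of_ne (hα2.trans hN') hαN
  refine ⟨RieszPotential.exists_isEquilibriumMeasure hE hW, fun μ hμ => ?_⟩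
  have hinf : ∀ S, RieszPotential.IsDominant E μ S → S.Infinite := fun S hS =>
    hS.infinite hN hα2 hαN hE hW hbd hμ
  exact ⟨fun m hm => RieszPotential.const_lt_constFin hα hE hμ hW hinf (by omega), hinf⟩
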